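/- Let $N\ge 1$ and $1\le r\le d$ be integers with $d\ge 3$ or $r\ge 2$. Let $\mathcal Y_{N,r}$ be the set of Young diagrams $\lambda=(\lambda_1\ge\dots\ge\lambda_d\ge 0)$, $\sum_i\lambda_i=N$, with at most $r$ nonempty rows. A Schur--Weyl decomposition $$(\mathbb C^d)^{\otimes N}\simeq\bigoplus_{\lambda\in\mathcal Y_{N,d}}\mathcal R_\lambda\otimes\mathcal M_\lambda$$ is a unitary identification under which $g^{\otimes N}$ acts as $\bigoplus_\lambda \pi_\lambda(g)\otimes I$ for all $g\in GL(d)$, where $(\pi_\lambda,\mathcal R_\lambda)$ is the irreducible representation of $GL(d)$ with highest weight $\lambda$ and $\mathcal M_\lambda\neq 0$ is the multiplicity space, of dimension $m_\lambda$. Such a decomposition exists. For each of them, let $\mathcal H_{\rm enc}=\bigoplus_{\lambda\in\mathcal Y_{N,r}}\mathcal R_\lambda$, let $\Pi_\lambda$ be the projector on $\mathcal R_\lambda\otimes\mathcal M_\lambda$, $\Pi=\sum_{\lambda\in\mathcal Y_{N,r}}\Pi_\lambda$, let $P_\lambda$ be the projector of $\mathcal H_{\rm enc}$ on $\mathcal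 R_\lambda$, let $\sigma$ be any density matrix on $\mathcal H_{\rm enc}$ (at least one exists), and put $$\mathcal E(\rho)=\bigoplus_{\lambda\in\mathcal Y_{N,r}}\mathrm{Tr}_{\mathcal M_\lambda}[\Pi_\lambda\rho\,\Pi_\lambda]+\mathrm{Tr}[(I-\Pi)\rho]\,\sigma,\qquad \mathcal D(\rho')=\bigoplus_{\lambda\in\mathcal Y_{N,r}}P_\lambda\rho' P_\lambda\otimes\frac{I_{m_\lambda}}{m_\lambda}.$$ Then $\mathcal E$ and $\mathcal D$ are quantum channels (completely positive and trace preserving). For every ensemble $\{\rho_x^{\otimes N},p_x\}$ (a discrete or continuous probability distribution over labels $x$) in which every $\rho_x$ is a density matrix of rank $r$ on $\mathbb C^d$, the protocol has zero error: $\mathcal D(\mathcal E(\rho_x^{\otimes N}))=\rho_x^{\otimes N}$ for every $x$, so the average error $\sum_x p_x\,\tfrac12\|\rho_x^{\otimes N}-\mathcal D(\mathcal E(\rho_x^{\otimes N}))\|_1$ (an integral for a continuous distribution) vanishes. The number of encoding qubits $\lceil\log_2\dim\mathcal H_{\rm enc}\rceil$ satisfies $$\lceil\log_2\dim\mathcal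 H_{\rm enc}\rceil<\frac{2dr-r^2+r-2}{2}\,\log_2(N+d-1).$$ -/

import Mathlib

open Matrix MeasureTheory
open scoped Kronecker ComplexOrder

noncomputable section

namespace SchurCompression

/-! ### States, tensor powers and channels, in matrix form -/

/-- Density matrices. -/
def IsDensity {n : Type*} [Fintype n] (ρ : Matrix n n ℂ) : Prop :=
  ρ.PosSemidef ∧ ρ.trace = 1

/-- The `N`-fold tensor power `A^{⊗N}`, a matrix on `(ℂ^d)^{⊗N}` whose product basis is
indexed by `Fin N → Fin d`. -/
def tensorPower {d : ℕ} (N : ℕ) (A : Matrix (Fin d) (Fin d) ℂ) :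
    Matrix (Fin N → Fin d) (Fin N → Fin d) ℂ :=
  Matrix.of fun a b => ∏ k, A (a k) (b k)

/-- The partial trace over the second tensor factor. -/
def traceRight {m n : Type*} [Fintype n] (A : Matrix (m × n) (m × n) ℂ) : Matrix m m ℂ :=
  Matrix.of fun i j => ∑ k, A (i, k) (j, k)

/-- The ampliation `Φ ⊗ id_k` of a linear map `Φ` on matrices. -/
def ampliate {m n : Type*} (Φ : Matrix m m ℂ →ₗ[ℂ] Matrix n n ℂ) (k : ℕ)
    (X : Matrix (m × Fin k) (m × Fin k) ℂ) : Matrix (n × Fin k) (n × Fin k) ℂ :=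
  Matrix.of fun p q => Φ (Matrix.of fun i j => X (i, p.2) (j, q.2)) p.1 q.1

/-- Quantum channels: completely positive trace-preserving linear maps. -/
structure IsChannel {m n : Type*} [Fintype m] [Fintype n]
    (Φ : Matrix m m ℂ →ₗ[ℂ] Matrix n n ℂ) : Prop where
  completelyPositive : ∀ (k : ℕ) (X : Matrix (m × Fin k) (m × Fin k) ℂ),
    X.PosSemidef → (ampliate Φ k X).PosSemidef
  tracePreserving : ∀ X, (Φ X).trace = X.trace

/-- The trace norm: the sum of the singular values. -/
def traceNorm {n : Type*} [Fintype n] [DecidableEq n] (A : Matrix n n ℂ) : ℝ :=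
  ∑ i, Real.sqrt ((Matrix.isHermitian_conjTranspose_mul_self A).eigenvalues i)

/-! ### Ensembles and the error of a compression protocol -/

/-- An ensemble `{ρ_x, p_x}` of rank-`r` states in dimension `d`: an arbitrary (discrete or
continuous) probability distribution over labels `x`, with a state `ρ_x` for every label.
The source emits `ρ_x^{⊗N}`. -/
structure Ensemble (d r : ℕ) (X : Type*) [MeasurableSpace X] where
  prob : Measure X
  isProbability : IsProbabilityMeasure prob
  state : X → Matrix (Fin d) (Fin d) ℂ
  isDensity : ∀ x, IsDensity (state x)
  rank_eq : ∀ x, (state x).rank = r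

/-- The average error `∑_x p_x ‖ρ_x^{⊗N} - D(E(ρ_x^{⊗N}))‖₁ / 2`. -/
def averageError {d r N : ℕ} {X H : Type*} [MeasurableSpace X] (ens : Ensemble d r X)
    (E : Matrix (Fin N → Fin d) (Fin N → Fin d) ℂ →ₗ[ℂ] Matrix H H ℂ)
    (D : Matrix H H ℂ →ₗ[ℂ] Matrix (Fin N → Fin d) (Fin N → Fin d) ℂ) : ℝ :=
  ∫ x, traceNorm (tensorPower N (ens.state x) - D (E (tensorPower N (ens.state x)))) / 2
    ∂ens.prob

/-- Zero-error compression: every decoded state equals the initial state, and hence the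
average error vanishes. -/
def ZeroError {d r N : ℕ} {X H : Type*} [MeasurableSpace X] (ens : Ensemble d r X)
    (E : Matrix (Fin N → Fin d) (Fin N → Fin d) ℂ →ₗ[ℂ] Matrix H H ℂ)
    (D : Matrix H H ℂ →ₗ[ℂ] Matrix (Fin N → Fin d) (Fin N → Fin d) ℂ) : Prop :=
  (∀ x, D (E (tensorPower N (ens.state x))) = tensorPower N (ens.state x)) ∧
    averageError ens E D = 0

/-! ### Schur-Weyl decompositions of `(ℂ^d)^{⊗N}` -/

/-- Young diagrams with `N` boxes arranged in `d` (possibly empty) rows,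
`λ_1 ≥ ⋯ ≥ λ_d ≥ 0`, `∑ λ_i = N`. -/
def Diagram (d N : ℕ) : Type :=
  {l : Fin d → ℕ // Antitone l ∧ ∑ i, l i = N}

/-- The length of a row. -/
def Diagram.row {d N : ℕ} (l : Diagram d N) (i : Fin d) : ℕ := l.1 i

/-- At most `r` rows are nonempty. -/
def Diagram.AtMost {d N : ℕ} (r : ℕ) (l : Diagram d N) : Prop :=
  ∀ i : Fin d, r ≤ (i : ℕ) → l.row i = 0

instance (d N : ℕ) : Finite (Diagram d N) := by
  refine Finite.of_injective
    (fun (l : Diagram d N) (i : Fin d) => (⟨l.1 i, Nat.lt_succ_of_le ?_⟩ : Fin (N + 1))) ?_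
  · calc l.1 i ≤ ∑ j, l.1 j := Finset.single_le_sum (fun _ _ => Nat.zero_le _) (Finset.mem_univ i)
      _ = N := l.2.2
  · intro l l' h
    apply Subtype.ext
    funext i
    simpa using congrFun h i

instance (d N : ℕ) : Fintype (Diagram d N) := Fintype.ofFinite _

instance (d N : ℕ) : DecidableEq (Diagram d N) := Classical.decEq _

instance (d N r : ℕ) : DecidablePred (Diagram.AtMost (d := d) (N := N) r) :=
  Classical.decPred _

/-- The diagrams with at most `r` nonempty rows. -/
abbrev Retained (d N r : ℕ) : Type := {l : Diagram d N // l.AtMost r}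

/-- The representation `π` of `GL(d)` has a highest-weight vector of weight `w`: a nonzero
vector `v` with `π(b) v = (∏ b_ii ^ w_i) v` for every invertible upper triangular `b`. -/
def HasHighestWeight {d : ℕ} {V : Type*} [AddCommGroup V] [Module ℂ V]
    (π : Representation ℂ (GL (Fin d) ℂ) V) (w : Fin d → ℕ) : Prop :=
  ∃ v : V, v ≠ 0 ∧ ∀ b : GL (Fin d) ℂ, (∀ i j : Fin d, j < i → b.1 i j = 0) →
    π b v = (∏ i, b.1 i i ^ w i) • v

/-- A Schur-Weyl decomposition `(ℂ^d)^{⊗N} ≃ ⨁_λ R_λ ⊗ M_λ` in orthonormal bases, where `λ`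
runs over all Young diagrams with `N` boxes in `d` rows: `R_λ = ℂ^{dimR λ}` is the irreducible
representation of `GL(d)` belonging to `λ` (that is, with highest weight `λ`),
`M_λ = ℂ^{dimM λ}` is the nonzero multiplicity space, and the unitary `U` turns the action
`g ↦ g^{⊗N}` into `g ↦ ⨁_λ π_λ(g) ⊗ 1`. -/
structure SchurWeyl (d N : ℕ) where
  dimR : Diagram d N → ℕ
  dimM : Diagram d N → ℕ
  dimM_pos : ∀ l, 0 < dimM l
  rep : ∀ l, Representation ℂ (GL (Fin d) ℂ) (Fin (dimR l) → ℂ)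
  irreducible : ∀ l, (rep l).IsIrreducible
  highestWeight : ∀ l, HasHighestWeight (rep l) l.row
  U : Matrix (Σ l, Fin (dimR l) × Fin (dimM l)) (Fin N → Fin d) ℂ
  U_mul_conjTranspose : U * U.conjTranspose = 1
  conjTranspose_mul_U : U.conjTranspose * U = 1
  block_form : ∀ g : GL (Fin d) ℂ,
    U * tensorPower N g.1 * U.conjTranspose =
      Matrix.blockDiagonal' fun l =>
        LinearMap.toMatrix' (rep l g) ⊗ₖ (1 : Matrix (Fin (dimM l)) (Fin (dimM l)) ℂ)

namespace SchurWeyl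

variable {d N : ℕ}

/-- The basis labels of the encoding space `H_enc = ⨁_λ R_λ`, the sum being over the diagrams
with at most `r` rows. -/
abbrev EncIdx (S : SchurWeyl d N) (r : ℕ) : Type :=
  Σ l : Retained d N r, Fin (S.dimR l.1)

/-- The projector on `⨁_λ R_λ ⊗ M_λ`, the sum being over the diagrams with at most `r` rows. -/
def retainedProj (S : SchurWeyl d N) (r : ℕ) :
    Matrix (Fin N → Fin d) (Fin N → Fin d) ℂ :=
  S.U.conjTranspose * Matrix.diagonal (fun p : Σ l, Fin (S.dimR l) × Fin (S.dimM l) =>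
    if p.1.AtMost r then (1 : ℂ) else 0) * S.U

/-- The encoding. It maps `ρ` to `⨁_λ Tr_{M_λ}[Π_λ ρ Π_λ]`, the sum being over the diagrams with
at most `r` rows; the weight `Tr[(1 - Π) ρ]` that `ρ` has outside their blocks is put on the
failure state `σ`, which makes the map trace preserving on the whole of `(ℂ^d)^{⊗N}`. -/
def encode (S : SchurWeyl d N) (r : ℕ) (σ : Matrix (S.EncIdx r) (S.EncIdx r) ℂ) :
    Matrix (Fin N → Fin d) (Fin N → Fin d) ℂ →ₗ[ℂ] Matrix (S.EncIdx r) (S.EncIdx r) ℂ where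
  toFun ρ :=
    Matrix.blockDiagonal' (fun l : Retained d N r =>
        traceRight (Matrix.blockDiag' (S.U * ρ * S.U.conjTranspose) l.1)) +
      ((1 - S.retainedProj r) * ρ).trace • σ
  map_add' ρ τ := by
    have h : (fun l : Retained d N r =>
          traceRight (Matrix.blockDiag' (S.U * (ρ + τ) * S.U.conjTranspose) l.1)) =
        (fun l : Retained d N r => traceRight (Matrix.blockDiag' (S.U * ρ * S.U.conjTranspose) l.1)) +
        (fun l : Retained d N r => traceRight (Matrix.blockDiag' (S.U * τ * S.U.conjTranspose) l.1)) := by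
      funext l
      ext i j
      simp [traceRight, Matrix.mul_add, Matrix.add_mul, Matrix.blockDiag'_apply,
        Finset.sum_add_distrib]
    rw [h, Matrix.blockDiagonal'_add, Matrix.mul_add, Matrix.trace_add, add_smul]
    abel
  map_smul' c ρ := by
    have h : (fun l : Retained d N r =>
          traceRight (Matrix.blockDiag' (S.U * (c • ρ) * S.U.conjTranspose) l.1)) =
        c • (fun l : Retained d N r =>
          traceRight (Matrix.blockDiag' (S.U * ρ * S.U.conjTranspose) l.1)) := by
      funext l
      ext i j
      simp [traceRight, Matrix.blockDiag'_apply, Finset.mul_sum]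
    rw [h, Matrix.blockDiagonal'_smul, Matrix.mul_smul, Matrix.trace_smul, smul_add, smul_assoc]
    rfl

/-- The block of the decoded state at the diagram `λ`: it is `P_λ Y P_λ ⊗ 1/m_λ` if `λ` has at most
`r` rows, where `P_λ` is the projector on `R_λ` and `m_λ = dim M_λ`, and `0` otherwise. -/
def decodeBlock (S : SchurWeyl d N) (r : ℕ) (Y : Matrix (S.EncIdx r) (S.EncIdx r) ℂ)
    (l : Diagram d N) :
    Matrix (Fin (S.dimR l) × Fin (S.dimM l)) (Fin (S.dimR l) × Fin (S.dimM l)) ℂ :=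
  if h : l.AtMost r then
    (Matrix.of fun i j : Fin (S.dimR l) => Y ⟨⟨l, h⟩, i⟩ ⟨⟨l, h⟩, j⟩) ⊗ₖ
      ((S.dimM l : ℂ)⁻¹ • (1 : Matrix (Fin (S.dimM l)) (Fin (S.dimM l)) ℂ))
  else 0

/-- The decoding `D(Y) = ⨁_λ P_λ Y P_λ ⊗ 1/m_λ`, the sum being over the diagrams with at most
`r` rows. -/
def decode (S : SchurWeyl d N) (r : ℕ) :
    Matrix (S.EncIdx r) (S.EncIdx r) ℂ →ₗ[ℂ] Matrix (Fin N → Fin d) (Fin N → Fin d) ℂ where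
  toFun Y := S.U.conjTranspose * Matrix.blockDiagonal' (S.decodeBlock r Y) * S.U
  map_add' Y Z := by
    have h : S.decodeBlock r (Y + Z) = S.decodeBlock r Y + S.decodeBlock r Z := by
      funext l
      by_cases h : l.AtMost r
      · ext i j
        simp [decodeBlock, h, Matrix.kroneckerMap_apply, add_mul]
      · simp [decodeBlock, h]
    rw [h, Matrix.blockDiagonal'_add, Matrix.mul_add, Matrix.add_mul]
  map_smul' c Y := by
    have h : S.decodeBlock r (c • Y) = c • S.decodeBlock r Y := by
      funext l
      by_cases h : l.AtMost r
      · ext i j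
        simp [decodeBlock, h, Matrix.kroneckerMap_apply, mul_assoc]
      · simp [decodeBlock, h]
    rw [h, Matrix.blockDiagonal'_smul, Matrix.mul_smul, Matrix.smul_mul, RingHom.id_apply]

/-- The number of qubits used by the protocol: the least `k` with `dim H_enc ≤ 2 ^ k`, that is
`⌈log₂ dim H_enc⌉`. -/
def numQubits (S : SchurWeyl d N) (r : ℕ) : ℕ :=
  Nat.clog 2 (Fintype.card (S.EncIdx r))

end SchurWeyl

end SchurCompression

end

open SchurCompression

noncomputable section

namespace SchurCompression

/-! ### Tensor powers: density of positive definite matrices, triangular factorization -/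

section TensorPower

variable {d N : ℕ}

/-! Everything rests on highest weight vectors and on the algebra `powerSpan` spanned by all
`X^{⊗N}`. It is closed under products and adjoints, and a polynomial argument shows that positive
definite `X` already span it. Such an `X` factors as `l * u` with `l` lower and `u` upper
triangular, so `⟨η, X^{⊗N} η'⟩ = ⟨(l^{⊗N})ᴴ η, u^{⊗N} η'⟩` is a scalar, depending only on `X` and
the weights, times `⟨η, η'⟩`. Hence different weights generate orthogonal modules, and all highest
weight vectors of one weight generate the same module up to scale (`star_dotProduct_mulVec_eq_zero`,
`star_dotProduct_mulVec_eq`).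

Existence of a decomposition: wedge products along the columns of a diagram give a highest weight
vector (`Diagram.exists_highestWeight`). The module it generates is `R_λ`, and the space of all
highest weight vectors of weight `λ` serves as `M_λ`. The span of all these modules has an invariant
orthogonal complement; it is zero, since a nonzero invariant subspace contains a highest weight
vector (`exists_mem_highestWeightSpace`), whose weight is dominant.

Dimension, for an arbitrary decomposition: `R_λ` is spanned by the vectors `L^{⊗N} ψ` with `L` lower
triangular and `ψ` of highest weight. Their coordinates are polynomials in the entries of `L` on or
below the diagonal in the first `r` columns, homogeneous in each column of degree the row length of
`λ`. Counting monomials bounds `dim R_λ`; different `λ` have different column degrees, so all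
retained `λ` together need at most the monomials of degree `N` in `t = dr - r(r-1)/2` variables
(`SchurWeyl.card_encIdx_le`). Twice this number is at most `(N+2)^(t-1)`, and the factor two absorbs
the rounding to whole qubits. The case `d = r = 2` needs a sharper count that uses dominance.

Zero error: if `rank X ≤ r`, write `X = Q * u` with `u` upper triangular; then `u` has a zero among
any `r + 1` leading diagonal entries, so `X^{⊗N}` kills the highest weight vectors of every diagram
with more than `r` rows, and then the whole block (`tensorPower_mulVec_embed`). On the other blocks
the state is `A_λ ⊗ 1`, which tracing out and re-tensoring with `1/m_λ` restores. The channel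
properties follow from explicit Kraus operators. -/

theorem tensorPower_apply (A : Matrix (Fin d) (Fin d) ℂ) (a b : Fin N → Fin d) :
    tensorPower N A a b = ∏ k, A (a k) (b k) := rfl

theorem tensorPower_mul (A B : Matrix (Fin d) (Fin d) ℂ) :
    tensorPower N (A * B) = tensorPower N A * tensorPower N B := by
  ext a b
  simp only [tensorPower_apply, Matrix.mul_apply, Finset.prod_univ_sum, Fintype.piFinset_univ,
    Finset.prod_mul_distrib]

theorem tensorPower_one : tensorPower N (1 : Matrix (Fin d) (Fin d) ℂ) = 1 := by
  ext a b
  by_cases h : a = b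
  · subst h; simp [tensorPower_apply]
  · obtain ⟨k, hk⟩ := Function.ne_iff.1 h
    rw [tensorPower_apply, Matrix.one_apply_ne h]
    exact Finset.prod_eq_zero (Finset.mem_univ k) (Matrix.one_apply_ne hk)

theorem tensorPower_conjTranspose (A : Matrix (Fin d) (Fin d) ℂ) :
    tensorPower N Aᴴ = (tensorPower N A)ᴴ := by
  ext a b
  simp [tensorPower_apply, Matrix.conjTranspose_apply]

/-- Along an affine line, a linear functional of the tensor power is a polynomial. -/
theorem exists_polynomial_tensorPower
    (φ : Matrix (Fin N → Fin d) (Fin N → Fin d) ℂ →ₗ[ℂ] ℂ) (A P : Matrix (Fin d) (Fin d) ℂ) :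
    ∃ p : Polynomial ℂ, ∀ z, p.eval z = φ (tensorPower N (A + z • P)) := by
  refine ⟨∑ a, ∑ b, Polynomial.C (φ (Matrix.single a b 1)) *
    ∏ k, (Polynomial.C (A (a k) (b k)) + Polynomial.X * Polynomial.C (P (a k) (b k))), fun z => ?_⟩
  conv_rhs => rw [Matrix.matrix_eq_sum_single (tensorPower N (A + z • P))]
  simp only [Polynomial.eval_finsetSum, Polynomial.eval_mul, Polynomial.eval_C,
    Polynomial.eval_prod, Polynomial.eval_add, Polynomial.eval_X, map_sum]
  refine Finset.sum_congr rfl fun a _ => Finset.sum_congr rfl fun b _ => ?_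
  have : Matrix.single a b (tensorPower N (A + z • P) a b) =
      (tensorPower N (A + z • P) a b) • Matrix.single a b (1 : ℂ) := by simp
  rw [this, map_smul, smul_eq_mul, mul_comm]
  simp [tensorPower_apply]

/-- If a subspace contains the tensor powers at infinitely many points of an affine line, it
contains the tensor powers on the whole line. -/
theorem tensorPower_line_mem
    (W : Submodule ℂ (Matrix (Fin N → Fin d) (Fin N → Fin d) ℂ)) (A P : Matrix (Fin d) (Fin d) ℂ)
    (S : Set ℂ) (hS : S.Infinite) (h : ∀ z ∈ S, tensorPower N (A + z • P) ∈ W) (z : ℂ) :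
    tensorPower N (A + z • P) ∈ W := by
  by_contra hz
  obtain ⟨φ, hφ, hW⟩ := Submodule.exists_le_ker_of_notMem hz
  obtain ⟨p, hp⟩ := exists_polynomial_tensorPower φ A P
  have : p = 0 := Polynomial.eq_zero_of_infinite_isRoot p <| hS.mono fun s hs => by
    rw [Set.mem_ofPred_eq, Polynomial.IsRoot, hp]
    exact hW (h s hs)
  exact hφ (by rw [← hp, this, Polynomial.eval_zero])

theorem infinite_nonneg_reals : {z : ℂ | 0 ≤ z}.Infinite :=
  (Set.infinite_range_of_injective (f := fun n : ℕ => (n : ℂ)) Nat.cast_injective).mono (by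
    rintro _ ⟨n, rfl⟩
    exact Nat.cast_nonneg (α := ℂ) n)

/-- Every matrix is a complex combination of four positive semidefinite matrices. -/
theorem eq_sum_posSemidef {n : Type*} [Fintype n] [DecidableEq n] (X : Matrix n n ℂ) :
    ∃ P : Fin 4 → Matrix n n ℂ, (∀ k, (P k).PosSemidef) ∧
      X = ∑ k : Fin 4, (Complex.I ^ (k : ℕ) / 4) • P k := by
  -- Polarization: in the sum of `i^k (X + i^k)(X + i^k)ᴴ / 4` over the fourth roots of unity only
  -- the term linear in `X` survives.
  refine ⟨fun k => (X + Complex.I ^ (k : ℕ) • 1) * (X + Complex.I ^ (k : ℕ) • 1)ᴴ,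
    fun k => Matrix.posSemidef_self_mul_conjTranspose _, ?_⟩
  have hI : Complex.I * Complex.I = -1 := Complex.I_mul_I
  simp only [Fin.sum_univ_four, Fin.val_zero, Fin.val_one, Fin.val_two,
    show ((3 : Fin 4) : ℕ) = 3 from rfl, conjTranspose_add, conjTranspose_smul, conjTranspose_one,
    add_mul, mul_add, smul_mul_assoc, mul_smul_comm, smul_add, smul_smul, one_mul, mul_one,
    pow_succ, pow_zero, hI, Complex.star_def, Complex.conj_I]
  match_scalars <;> (try simp only [map_mul, map_neg, map_one, Complex.conj_I]) <;> ring_nf <;>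
    (simp [Complex.I_sq]; try norm_num)

/-- The tensor powers of positive definite matrices span those of all matrices. -/
theorem tensorPower_mem_of_posDef
    (W : Submodule ℂ (Matrix (Fin N → Fin d) (Fin N → Fin d) ℂ))
    (h : ∀ X : Matrix (Fin d) (Fin d) ℂ, X.PosDef → tensorPower N X ∈ W)
    (X : Matrix (Fin d) (Fin d) ℂ) : tensorPower N X ∈ W := by
  obtain ⟨P, hP, hX⟩ := eq_sum_posSemidef (X - 1)
  -- The four summands are added one at a time. For nonnegative coefficients the base point stays
  -- positive definite, and the line lemma then admits every complex coefficient.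
  have key : ∀ s : Finset (Fin 4), ∀ A : Matrix (Fin d) (Fin d) ℂ, A.PosDef → ∀ c : Fin 4 → ℂ,
      tensorPower N (A + ∑ k ∈ s, c k • P k) ∈ W := by
    intro s
    induction s using Finset.induction_on with
    | empty => intro A hA c; simpa using h A hA
    | insert k s hk ih =>
      intro A hA c
      rw [Finset.sum_insert hk, add_left_comm, add_comm]
      refine tensorPower_line_mem W _ _ _ infinite_nonneg_reals (fun z hz => ?_) (c k)
      rw [add_right_comm]
      exact ih _ (hA.add_posSemidef ((hP k).smul hz)) c
  have := key Finset.univ 1 Matrix.PosDef.one fun k => Complex.I ^ (k : ℕ) / 4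
  rwa [← hX, add_sub_cancel] at this

/-- A positive definite matrix is the product of an invertible lower triangular matrix and an
invertible upper triangular one. -/
theorem PosDef.exists_lower_mul_upper {X : Matrix (Fin d) (Fin d) ℂ} (hX : X.PosDef) :
    ∃ l u : GL (Fin d) ℂ, (∀ i j : Fin d, i < j → l.1 i j = 0) ∧
      (∀ i j : Fin d, j < i → u.1 i j = 0) ∧ X = l.1 * u.1 := by
  have hlow : (LDL.lower hX).BlockTriangular OrderDual.toDual :=
    Matrix.blockTriangular_inv_of_blockTriangular (M := LDL.lowerInv hX)
      fun i j hij => LDL.lowerInv_triangular hX hij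
  have hlow' : ∀ i j : Fin d, i < j → LDL.lower hX i j = 0 := fun i j hij => hlow hij
  have hl : IsUnit (LDL.lower hX) := by
    rw [LDL.lower, Matrix.isUnit_nonsing_inv_iff]
    exact isUnit_of_invertible _
  have hu : IsUnit (LDL.diag hX * (LDL.lower hX)ᴴ) := by
    have h := hX.isUnit
    rw [← LDL.lower_conj_diag hX, Matrix.mul_assoc, Matrix.isUnit_iff_isUnit_det,
      Matrix.det_mul] at h
    rw [Matrix.isUnit_iff_isUnit_det]
    exact isUnit_of_mul_isUnit_right h
  refine ⟨hl.unit, hu.unit, hlow', fun i j hij => ?_, ?_⟩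
  · simp [LDL.diag, Matrix.diagonal_mul, Matrix.conjTranspose_apply, hlow' j i hij]
  · rw [IsUnit.unit_spec, IsUnit.unit_spec, ← Matrix.mul_assoc, LDL.lower_conj_diag]

end TensorPower

/-! ### The algebra of tensor powers and its highest weight vectors -/

section HighestWeight

variable {d N : ℕ}

/-- The complex span of the tensor powers `X^{⊗N}`. -/
def powerSpan (d N : ℕ) : Submodule ℂ (Matrix (Fin N → Fin d) (Fin N → Fin d) ℂ) :=
  Submodule.span ℂ (Set.range (tensorPower N))

theorem tensorPower_mem_powerSpan (X : Matrix (Fin d) (Fin d) ℂ) :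
    tensorPower N X ∈ powerSpan d N :=
  Submodule.subset_span ⟨X, rfl⟩

theorem powerSpan_le_of_posDef (W : Submodule ℂ (Matrix (Fin N → Fin d) (Fin N → Fin d) ℂ))
    (h : ∀ X : Matrix (Fin d) (Fin d) ℂ, X.PosDef → tensorPower N X ∈ W) : powerSpan d N ≤ W :=
  Submodule.span_le.2 (by rintro _ ⟨X, rfl⟩; exact tensorPower_mem_of_posDef W h X)

/-- Generators may be taken positive definite, hence invertible and factorable into triangular
matrices, which is what the later inductions need. -/
theorem powerSpan_induction
    {p : (M : Matrix (Fin N → Fin d) (Fin N → Fin d) ℂ) → M ∈ powerSpan d N → Prop}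
    (posDef : ∀ (X : Matrix (Fin d) (Fin d) ℂ) (_ : X.PosDef),
      p (tensorPower N X) (tensorPower_mem_powerSpan X))
    (zero : p 0 (zero_mem _))
    (add : ∀ A B hA hB, p A hA → p B hB → p (A + B) (add_mem hA hB))
    (smul : ∀ (c : ℂ) A hA, p A hA → p (c • A) (Submodule.smul_mem _ c hA))
    {M : Matrix (Fin N → Fin d) (Fin N → Fin d) ℂ} (hM : M ∈ powerSpan d N) : p M hM :=
  (powerSpan_le_of_posDef
    { carrier := {A | ∃ hA, p A hA}
      zero_mem' := ⟨_, zero⟩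
      add_mem' := fun ⟨hA, pA⟩ ⟨hB, pB⟩ => ⟨_, add _ _ hA hB pA pB⟩
      smul_mem' := fun c _ ⟨hA, pA⟩ => ⟨_, smul c _ hA pA⟩ }
    (fun X hX => ⟨_, posDef X hX⟩) hM).2

theorem powerSpan_mul_mem {A B : Matrix (Fin N → Fin d) (Fin N → Fin d) ℂ}
    (hA : A ∈ powerSpan d N) (hB : B ∈ powerSpan d N) : A * B ∈ powerSpan d N := by
  induction hA using powerSpan_induction with
  | posDef X _ =>
    induction hB using powerSpan_induction with
    | posDef Y _ => rw [← tensorPower_mul]; exact tensorPower_mem_powerSpan _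
    | zero => simp
    | add A B _ _ hA hB => rw [mul_add]; exact add_mem hA hB
    | smul c A _ hA => rw [mul_smul_comm]; exact Submodule.smul_mem _ _ hA
  | zero => simp
  | add A B _ _ hA hB => rw [add_mul]; exact add_mem hA hB
  | smul c A _ hA => rw [smul_mul_assoc]; exact Submodule.smul_mem _ _ hA

theorem powerSpan_conjTranspose_mem {A : Matrix (Fin N → Fin d) (Fin N → Fin d) ℂ}
    (hA : A ∈ powerSpan d N) : Aᴴ ∈ powerSpan d N := by
  induction hA using powerSpan_induction with
  | posDef X _ => rw [← tensorPower_conjTranspose]; exact tensorPower_mem_powerSpan _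
  | zero => simp
  | add A B _ _ hA hB => rw [conjTranspose_add]; exact add_mem hA hB
  | smul c A _ hA => rw [conjTranspose_smul]; exact Submodule.smul_mem _ _ hA

/-- How often each value is taken. -/
def content (a : Fin N → Fin d) (i : Fin d) : ℕ := (Finset.univ.filter (a · = i)).card

theorem prod_comp_eq_prod_pow_content (t : Fin d → ℂ) (a : Fin N → Fin d) :
    ∏ k, t (a k) = ∏ i, t i ^ content a i := by
  rw [← Finset.prod_fiberwise' Finset.univ a t]
  simp [content]

theorem sum_content (a : Fin N → Fin d) : ∑ i, content a i = N := by
  simpa [content] using (Finset.card_eq_sum_card_fiberwise (f := a) (s := Finset.univ)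
    (t := Finset.univ) (by simp)).symm

/-- The vectors of `(ℂ^d)^{⊗N}` on which upper triangular matrices act by the weight `w`. -/
def highestWeightSpace (N : ℕ) (w : Fin d → ℕ) : Submodule ℂ ((Fin N → Fin d) → ℂ) where
  carrier := {ψ | ∀ b : GL (Fin d) ℂ, (∀ i j : Fin d, j < i → b.1 i j = 0) →
    tensorPower N b.1 *ᵥ ψ = (∏ i, b.1 i i ^ w i) • ψ}
  zero_mem' := by simp
  add_mem' := fun hx hy b hb => by rw [mulVec_add, hx b hb, hy b hb, smul_add]
  smul_mem' := fun c x hx b hb => by rw [mulVec_smul, hx b hb, smul_comm]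

theorem tensorPower_diagonal (t : Fin d → ℂ) :
    tensorPower N (diagonal t) = diagonal fun a => ∏ k, t (a k) := by
  ext a b
  by_cases h : a = b
  · subst h; simp [tensorPower_apply]
  · obtain ⟨k, hk⟩ := Function.ne_iff.1 h
    rw [tensorPower_apply, Matrix.diagonal_apply_ne _ h]
    exact Finset.prod_eq_zero (Finset.mem_univ k) (Matrix.diagonal_apply_ne _ hk)

/-- Invertible diagonal matrices. -/
def diagonalGL (t : Fin d → ℂ) (ht : ∀ i, t i ≠ 0) : GL (Fin d) ℂ :=
  Matrix.GeneralLinearGroup.mkOfDetNeZero (diagonal t) (by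
    rw [det_diagonal]; exact Finset.prod_ne_zero_iff.2 fun i _ => ht i)

/-- Tested on the diagonal matrix with one entry 2 and all others 1, the weight condition compares
two powers of 2. -/
theorem highestWeightSpace_content {w : Fin d → ℕ} {ψ : (Fin N → Fin d) → ℂ}
    (hψ : ψ ∈ highestWeightSpace N w) {a : Fin N → Fin d} (ha : ψ a ≠ 0) : content a = w := by
  funext i
  have ht : ∀ j, (Function.update 1 i 2 : Fin d → ℂ) j ≠ 0 := fun j => by
    by_cases h : j = i
    · subst h; simp
    · simp [h]
  have h := congrFun (hψ (diagonalGL _ ht) fun j k hkj => by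
    simp [diagonalGL, Matrix.GeneralLinearGroup.mkOfDetNeZero, hkj.ne']) a
  have hp : ∀ v : Fin d → ℕ, ∏ j, (Function.update 1 i 2 : Fin d → ℂ) j ^ v j = 2 ^ v i := by
    intro v
    rw [Finset.prod_eq_single i (fun j _ hj => by simp [hj]) (by simp)]
    simp
  simp only [diagonalGL, Matrix.GeneralLinearGroup.val_mkOfDetNeZero, tensorPower_diagonal,
    mulVec_diagonal, prod_comp_eq_prod_pow_content, Pi.smul_apply, smul_eq_mul,
    diagonal_apply_eq, hp] at h
  have h2 := mul_right_cancel₀ ha h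
  exact Nat.pow_right_injective le_rfl (by exact_mod_cast h2)

/-- The supports are disjoint, because a product basis index has only one content. -/
theorem star_dotProduct_eq_zero_of_weight_ne {w w' : Fin d → ℕ} (hw : w ≠ w')
    {η η' : (Fin N → Fin d) → ℂ} (hη : η ∈ highestWeightSpace N w)
    (hη' : η' ∈ highestWeightSpace N w') : star η ⬝ᵥ η' = 0 := by
  refine Finset.sum_eq_zero fun a _ => ?_
  by_contra h
  have h1 : η a ≠ 0 := fun h0 => h (by simp [h0])
  have h2 : η' a ≠ 0 := fun h0 => h (by simp [h0])
  exact hw ((highestWeightSpace_content hη h1).symm.trans (highestWeightSpace_content hη' h2))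

theorem star_dotProduct_mulVec {m : Type*} [Fintype m] (M : Matrix m m ℂ) (x y : m → ℂ) :
    star x ⬝ᵥ M *ᵥ y = star (Mᴴ *ᵥ x) ⬝ᵥ y := by
  rw [star_mulVec, conjTranspose_conjTranspose, dotProduct_mulVec]

/-- For a positive definite `X` the matrix elements of `X^{⊗N}` between highest weight vectors
are a common multiple of the inner products. -/
theorem exists_star_dotProduct_tensorPower {X : Matrix (Fin d) (Fin d) ℂ} (hX : X.PosDef)
    (w w' : Fin d → ℕ) : ∃ c : ℂ, ∀ η ∈ highestWeightSpace N w, ∀ η' ∈ highestWeightSpace N w',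
      star η ⬝ᵥ tensorPower N X *ᵥ η' = c * (star η ⬝ᵥ η') := by
  obtain ⟨l, u, hl, hu, rfl⟩ := PosDef.exists_lower_mul_upper hX
  have hdet : IsUnit l.1ᴴ := l.isUnit.star
  refine ⟨star (∏ i, hdet.unit.1 i i ^ w i) * ∏ i, u.1 i i ^ w' i, fun η hη η' hη' => ?_⟩
  have h1 := hη hdet.unit fun i j hij => by simp [conjTranspose_apply, hl j i hij]
  rw [tensorPower_mul, ← mulVec_mulVec, star_dotProduct_mulVec, ← tensorPower_conjTranspose,
    hη' u hu]
  rw [IsUnit.unit_spec] at h1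
  rw [h1, star_smul, smul_dotProduct, dotProduct_smul, IsUnit.unit_spec, smul_eq_mul, smul_eq_mul,
    mul_assoc]

theorem star_dotProduct_mulVec_eq_zero {w w' : Fin d → ℕ} (hw : w ≠ w')
    {η η' : (Fin N → Fin d) → ℂ} (hη : η ∈ highestWeightSpace N w)
    (hη' : η' ∈ highestWeightSpace N w') {M : Matrix (Fin N → Fin d) (Fin N → Fin d) ℂ}
    (hM : M ∈ powerSpan d N) : star η ⬝ᵥ M *ᵥ η' = 0 := by
  induction hM using powerSpan_induction with
  | posDef X hX =>
    obtain ⟨c, hc⟩ := exists_star_dotProduct_tensorPower (N := N) hX w w'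
    rw [hc η hη η' hη', star_dotProduct_eq_zero_of_weight_ne hw hη hη', mul_zero]
  | zero => simp
  | add A B _ _ hA hB => rw [add_mulVec, dotProduct_add, hA, hB, add_zero]
  | smul c A _ hA => rw [smul_mulVec, dotProduct_smul, hA, smul_zero]

/-- The scalar that `X` produces does not depend on the pair of vectors, so it can be read off at
the unit vector `ψ`; both sides are linear in `M`. -/
theorem star_dotProduct_mulVec_eq {w : Fin d → ℕ} {η η' ψ : (Fin N → Fin d) → ℂ}
    (hη : η ∈ highestWeightSpace N w) (hη' : η' ∈ highestWeightSpace N w)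
    (hψ : ψ ∈ highestWeightSpace N w) (hψ1 : star ψ ⬝ᵥ ψ = 1)
    {M : Matrix (Fin N → Fin d) (Fin N → Fin d) ℂ} (hM : M ∈ powerSpan d N) :
    star η ⬝ᵥ M *ᵥ η' = (star ψ ⬝ᵥ M *ᵥ ψ) * (star η ⬝ᵥ η') := by
  induction hM using powerSpan_induction with
  | posDef X hX =>
    obtain ⟨c, hc⟩ := exists_star_dotProduct_tensorPower (N := N) hX w w
    rw [hc η hη η' hη', hc ψ hψ ψ hψ, hψ1, mul_one]
  | zero => simp
  | add A B _ _ hA hB => simp only [add_mulVec, dotProduct_add, hA, hB, add_mul]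
  | smul c A _ hA => simp only [smul_mulVec, dotProduct_smul, hA, smul_eq_mul, mul_assoc]

/-- The lower triangular matrices suffice to generate a module from a highest weight vector. -/
theorem mulVec_mem_span_lower {w : Fin d → ℕ} {ψ : (Fin N → Fin d) → ℂ}
    (hψ : ψ ∈ highestWeightSpace N w) {M : Matrix (Fin N → Fin d) (Fin N → Fin d) ℂ}
    (hM : M ∈ powerSpan d N) :
    M *ᵥ ψ ∈ Submodule.span ℂ {φ | ∃ l : Matrix (Fin d) (Fin d) ℂ,
      (∀ i j : Fin d, i < j → l i j = 0) ∧ φ = tensorPower N l *ᵥ ψ} := by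
  induction hM using powerSpan_induction with
  | posDef X hX =>
    obtain ⟨l, u, hl, hu, rfl⟩ := PosDef.exists_lower_mul_upper hX
    rw [tensorPower_mul, ← mulVec_mulVec, hψ u hu, mulVec_smul]
    exact Submodule.smul_mem _ _ (Submodule.subset_span ⟨l.1, hl, rfl⟩)
  | zero => simp
  | add A B _ _ hA hB => rw [add_mulVec]; exact add_mem hA hB
  | smul c A _ hA => rw [smul_mulVec]; exact Submodule.smul_mem _ _ hA

/-- A lower triangular tensor power can only raise the entries of a product basis index, and these
suffice to generate the module. -/
theorem exists_le_of_mulVec_ne_zero {w : Fin d → ℕ} {ψ : (Fin N → Fin d) → ℂ}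
    (hψ : ψ ∈ highestWeightSpace N w) {M : Matrix (Fin N → Fin d) (Fin N → Fin d) ℂ}
    (hM : M ∈ powerSpan d N) {a : Fin N → Fin d} (ha : (M *ᵥ ψ) a ≠ 0) :
    ∃ b, b ≤ a ∧ content b = w := by
  suffices h : ∀ φ ∈ Submodule.span ℂ {φ | ∃ l : Matrix (Fin d) (Fin d) ℂ,
      (∀ i j : Fin d, i < j → l i j = 0) ∧ φ = tensorPower N l *ᵥ ψ},
      φ a ≠ 0 → ∃ b, b ≤ a ∧ content b = w from h _ (mulVec_mem_span_lower hψ hM) ha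
  intro φ hφ
  induction hφ using Submodule.span_induction with
  | mem φ hφ =>
    obtain ⟨l, hl, rfl⟩ := hφ
    intro h
    obtain ⟨b, -, hb⟩ := Finset.exists_ne_zero_of_sum_ne_zero h
    refine ⟨b, fun k => ?_, highestWeightSpace_content hψ (right_ne_zero_of_mul hb)⟩
    by_contra hk
    exact left_ne_zero_of_mul hb
      (Finset.prod_eq_zero (Finset.mem_univ k) (hl _ _ (not_le.1 hk)))
  | zero => simp
  | add x y _ _ hx hy =>
    intro h
    by_cases h0 : x a = 0
    · exact hy fun h1 => h (by simp [h0, h1])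
    · exact hx h0
  | smul c x _ hx => exact fun h => hx (right_ne_zero_of_mul h)

/-- Highest weights of nonzero vectors are dominant. -/
theorem antitone_of_mem_highestWeightSpace {w : Fin d → ℕ} {ψ : (Fin N → Fin d) → ℂ}
    (hψ : ψ ∈ highestWeightSpace N w) (h0 : ψ ≠ 0) : Antitone w := by
  obtain ⟨a, ha⟩ := Function.ne_iff.1 h0
  have hc := highestWeightSpace_content hψ ha
  intro i j hij
  rcases hij.eq_or_lt with rfl | hij
  · exact le_rfl
  -- Swapping `i` and `j` yields a vector of the module with a nonzero coordinate at `s ∘ a`, which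
  -- therefore dominates some `b` of content `w`. Counting positions with entry at most `i` on both
  -- sides gives `w j ≤ w i`.
  let s := Equiv.swap i j
  have hs : (tensorPower N (s.toPEquiv.toMatrix : Matrix (Fin d) (Fin d) ℂ) *ᵥ ψ)
      (fun k => s (a k)) = ψ a := by
    rw [mulVec, dotProduct, Finset.sum_eq_single a]
    · rw [tensorPower_apply, Finset.prod_eq_one, one_mul]
      intro k _
      simp [PEquiv.toMatrix_apply, s]
    · intro b _ hb
      obtain ⟨k, hk⟩ := Function.ne_iff.1 hb
      rw [tensorPower_apply, Finset.prod_eq_zero (Finset.mem_univ k), zero_mul]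
      simp [PEquiv.toMatrix_apply, s, Ne.symm hk]
    · simp
  obtain ⟨b, hb, hbw⟩ := exists_le_of_mulVec_ne_zero hψ (tensorPower_mem_powerSpan _)
    (hs.trans_ne ha)
  have hsum : ∀ c : Fin N → Fin d, content c = w →
      (Finset.univ.filter fun k => c k ≤ i).card =
        (∑ x ∈ Finset.univ.filter (· < i), w x) + w i := by
    intro c hcw
    rw [Finset.card_eq_sum_card_fiberwise (f := c) (t := Finset.univ.filter (· ≤ i))
      (by intro k; simp)]
    have : Finset.univ.filter (· ≤ i) = insert i (Finset.univ.filter (· < i)) := by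
      ext x; simp [le_iff_eq_or_lt]
    rw [this, Finset.sum_insert (by simp), add_comm, ← hcw]
    congr 1
    · refine Finset.sum_congr rfl fun x hx => ?_
      rw [content, Finset.filter_filter]
      congr 1
      ext k
      simp only [Finset.mem_filter, Finset.mem_univ, true_and] at hx ⊢
      exact ⟨fun h => h.2, fun h => ⟨h ▸ hx.le, h⟩⟩
    · rw [content, Finset.filter_filter]
      congr 1
      ext k
      simp only [Finset.mem_filter, Finset.mem_univ, true_and]
      exact ⟨fun h => h.2, fun h => ⟨h.le, h⟩⟩
  have hle : (Finset.univ.filter fun k => a k < i ∨ a k = j).card ≤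
      (Finset.univ.filter fun k => b k ≤ i).card := by
    refine Finset.card_le_card fun k hk => ?_
    simp only [Finset.mem_filter, Finset.mem_univ, true_and] at hk ⊢
    refine (hb k).trans ?_
    rcases hk with hk | hk
    · simp only [s, Equiv.swap_apply_of_ne_of_ne hk.ne (hk.trans hij).ne]
      exact hk.le
    · simp [s, hk]
  rw [hsum b hbw, Finset.filter_or, Finset.card_union_of_disjoint (by
    rw [Finset.disjoint_filter]
    intro k _ hk hkj
    exact absurd (hkj ▸ hk) (not_lt.2 hij.le))] at hle
  have hlt : (Finset.univ.filter fun k => a k < i).card = ∑ x ∈ Finset.univ.filter (· < i), w x := by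
    have h1 := hsum a hc
    have h2 : (Finset.univ.filter fun k => a k ≤ i).card =
        (Finset.univ.filter fun k => a k < i).card + w i := by
      rw [← hc, content, ← Finset.card_union_of_disjoint (by
        rw [Finset.disjoint_filter]; intro k _ hk; exact hk.ne), ← Finset.filter_or]
      simp [le_iff_lt_or_eq]
    omega
  have : (Finset.univ.filter fun k => a k = j).card = w j := by rw [← hc]; rfl
  omega

/-- A nonzero subspace which is invariant under all tensor powers contains a highest weight
vector. -/
theorem exists_mem_highestWeightSpace (W : Submodule ℂ ((Fin N → Fin d) → ℂ))
    (hW : ∀ M ∈ powerSpan d N, ∀ ψ ∈ W, M *ᵥ ψ ∈ W) (hne : W ≠ ⊥) :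
    ∃ (a : Fin N → Fin d) (ψ : (Fin N → Fin d) → ℂ), ψ ∈ W ∧ ψ ≠ 0 ∧
      ψ ∈ highestWeightSpace N (content a) := by
  have top : ∀ ψ : (Fin N → Fin d) → ℂ, ψ ≠ 0 →
      ∃ a, ψ a ≠ 0 ∧ ∀ a', toLex a < toLex a' → ψ a' = 0 := by
    intro ψ hψ
    obtain ⟨a, ha⟩ := Function.ne_iff.1 hψ
    obtain ⟨m, hm, hmax⟩ := Finset.exists_max_image (Finset.univ.filter fun a => ψ a ≠ 0) toLex
      ⟨a, by simpa using ha⟩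
    refine ⟨m, by simpa using hm, fun a' ha' => ?_⟩
    by_contra h
    exact absurd (hmax a' (by simpa using h)) (not_le.2 ha')
  -- The lexicographically largest support indices of vectors of `W`. A vector whose leading index
  -- is least turns out to be a highest weight vector.
  let S : Set (Lex (Fin N → Fin d)) :=
    {a | ∃ ψ ∈ W, ψ (ofLex a) ≠ 0 ∧ ∀ a', a < toLex a' → ψ a' = 0}
  have hS : S.Nonempty := by
    obtain ⟨ψ, hψ, h0⟩ := (Submodule.ne_bot_iff _).1 hne
    obtain ⟨a, ha, ha'⟩ := top ψ h0
    exact ⟨toLex a, ψ, hψ, ha, ha'⟩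
  have hmin : ∃ a ∈ S, ∀ b ∈ S, a ≤ b := by
    obtain ⟨a, ha, h⟩ := S.toFinite.exists_minimal hS
    exact ⟨a, ha, fun b hb => le_of_not_gt fun hlt => absurd (h hb hlt.le) (not_le.2 hlt)⟩
  obtain ⟨a, ⟨ψ, hψ, ha, hlt⟩, hmin⟩ := hmin
  refine ⟨ofLex a, ψ, hψ, fun h => ha (by simp [h]), fun b hb => ?_⟩
  rw [← sub_eq_zero]
  by_contra hne0
  obtain ⟨a', ha', hlt'⟩ := top _ hne0
  have hmem : toLex a' ∈ S :=
    ⟨_, sub_mem (hW _ (tensorPower_mem_powerSpan b.1) ψ hψ) (Submodule.smul_mem W _ hψ), ha', hlt'⟩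
  have hle := hmin _ hmem
  -- Upper triangularity leaves only `c ≥ a'` entrywise, and `ψ` vanishes at those other than `a'`.
  -- The diagonal term cancels too, so the coordinate at `a'` is zero after all.
  have hterm : ∀ c, c ≠ a' → tensorPower N b.1 a' c * ψ c = 0 := by
    intro c hc
    by_cases hac : a' ≤ c
    · rw [hlt c (hle.trans_lt (lt_of_le_of_ne (Pi.toLex_monotone hac) fun h => hc h.symm)), mul_zero]
    · obtain ⟨k, hk⟩ := not_forall.1 hac
      rw [tensorPower_apply, Finset.prod_eq_zero (Finset.mem_univ k) (hb _ _ (not_le.1 hk)),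
        zero_mul]
  apply ha'
  rw [Pi.sub_apply, mulVec, dotProduct, Finset.sum_eq_single a' (fun c _ => hterm c) (by simp),
    Pi.smul_apply, smul_eq_mul]
  rcases hle.eq_or_lt with h | h
  · rw [tensorPower_apply, prod_comp_eq_prod_pow_content (fun i => b.1 i i), h, ofLex_toLex,
      sub_self]
  · simp [hlt a' h]

end HighestWeight

/-! ### A highest weight vector for every Young diagram -/

section ColumnVector

variable {d N : ℕ}

/-- The antisymmetric tensor `e_1 ∧ e_2 ∧ ⋯` on the positions in `C`. -/
def columnVector (C : Fin d → Prop) [DecidablePred C] (c : {i // C i} → Fin d) : ℂ :=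
  det (of fun i i' : {i // C i} => if c i = i' then (1 : ℂ) else 0)

/-- Leibniz expansion of the action of `b` on a wedge of basis vectors. -/
theorem sum_prod_mul_columnVector (C : Fin d → Prop) [DecidablePred C]
    (b : Matrix (Fin d) (Fin d) ℂ) (α : {i // C i} → Fin d) :
    ∑ c : {i // C i} → Fin d, (∏ i, b (α i) (c i)) * columnVector C c =
      det (of fun i i' : {i // C i} => b (α i) i') := by
  simp only [columnVector, ← det_transpose (of _), det_apply', Finset.mul_sum, transpose_apply,
    of_apply]
  rw [Finset.sum_comm]
  refine Finset.sum_congr rfl fun σ _ => ?_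
  have h : ∏ i, b (α i) (σ i) =
      ∑ c : {i // C i} → Fin d, ∏ i, (b (α i) (c i) * if c i = σ i then (1 : ℂ) else 0) := by
    rw [← Fintype.piFinset_univ, ← Finset.prod_univ_sum (fun _ => Finset.univ)
      fun i k => b (α i) k * if k = σ i then (1 : ℂ) else 0]
    simp
  rw [h, Finset.mul_sum]
  refine Finset.sum_congr rfl fun c _ => ?_
  rw [Finset.prod_mul_distrib]
  ring

/-- As `C` is an initial segment, an upper triangular `b` preserves the span of the basis vectors in
`C`; the wedge is scaled by the determinant of that block. -/
theorem det_eq_columnVector_mul (C : Fin d → Prop) [DecidablePred C]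
    (hC : ∀ i j, i ≤ j → C j → C i) (b : Matrix (Fin d) (Fin d) ℂ)
    (hb : ∀ i j : Fin d, j < i → b i j = 0) (α : {i // C i} → Fin d) :
    det (of fun i i' : {i // C i} => b (α i) i') =
      (∏ i : {i // C i}, b i i) * columnVector C α := by
  have h : (of fun i i' : {i // C i} => b (α i) i') =
      (of fun i i' : {i // C i} => if α i = i' then (1 : ℂ) else 0) *
        of fun i i' : {i // C i} => b i i' := by
    ext i i'
    simp only [mul_apply, of_apply, ite_mul, one_mul, zero_mul]
    by_cases h : C (α i)
    · rw [Finset.sum_eq_single ⟨α i, h⟩ (fun k _ hk => if_neg fun h' => hk (Subtype.ext h'.symm))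
        (by simp)]
      simp
    · rw [hb _ _ (not_le.1 fun h' => h (hC _ _ h' i'.2))]
      exact (Finset.sum_eq_zero fun k _ => if_neg fun h' => h (by rw [h']; exact k.2)).symm
  rw [h, det_mul, mul_comm, columnVector]
  congr 1
  exact det_of_isUpperTriangular fun i j hij => hb _ _ hij

theorem columnVector_val (C : Fin d → Prop) [DecidablePred C] :
    columnVector C (fun i => i) = 1 := by
  rw [columnVector, ← det_one (n := {i // C i})]
  congr 1
  ext i j
  simp [one_apply, Subtype.ext_iff]

theorem Diagram.row_le (l : Diagram d N) (i : Fin d) : l.row i ≤ N :=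
  (Finset.single_le_sum (f := l.1) (fun _ _ => Nat.zero_le _) (Finset.mem_univ i)).trans l.2.2.le

theorem card_filter_val_lt {m : ℕ} (h : m ≤ N) :
    (Finset.univ.filter fun j : Fin N => (j : ℕ) < m).card = m := by
  simpa using Fin.card_filter_val_lt (n := N) (m := m) |>.trans (min_eq_right h)

theorem Diagram.card_boxes (l : Diagram d N) :
    Fintype.card (Fin N) = Fintype.card (Σ j : Fin N, {i : Fin d // (j : ℕ) < l.row i}) := by
  rw [Fintype.card_sigma, Fintype.card_fin]
  simp only [Fintype.card_subtype, Finset.card_filter]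
  rw [Finset.sum_comm]
  simp only [← Finset.card_filter, card_filter_val_lt (l.row_le _)]
  exact l.2.2.symm

/-- Every Young diagram is a highest weight of `(ℂ^d)^{⊗N}`: take an antisymmetric tensor for every
column. -/
theorem Diagram.exists_highestWeight (l : Diagram d N) :
    ∃ ψ ∈ highestWeightSpace N l.row, ψ ≠ 0 := by
  let C : Fin N → Fin d → Prop := fun j i => (j : ℕ) < l.row i
  -- Tensor factors are matched with the boxes of the diagram, grouped by columns.
  let e : Fin N ≃ Σ j : Fin N, {i : Fin d // C j i} := Fintype.equivOfCardEq l.card_boxes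
  let E : (Fin N → Fin d) ≃ ∀ j : Fin N, {i : Fin d // C j i} → Fin d :=
    (e.arrowCongr (Equiv.refl _)).trans
      (Equiv.piCurry (γ := fun (j : Fin N) (_ : {i : Fin d // C j i}) => Fin d))
  have hE : ∀ a j i, E a j i = a (e.symm ⟨j, i⟩) := fun _ _ _ => rfl
  refine ⟨fun a => ∏ j, columnVector (C j) (E a j), fun b hb => ?_, fun h => ?_⟩
  · funext a
    have h1 : ∀ a', tensorPower N b.1 a a' * ∏ j, columnVector (C j) (E a' j) =
        ∏ j, ((∏ i, b.1 (E a j i) (E a' j i)) * columnVector (C j) (E a' j)) := by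
      intro a'
      rw [Finset.prod_mul_distrib, tensorPower_apply, ← Equiv.prod_comp e.symm,
        Fintype.prod_sigma]
      rfl
    rw [mulVec, dotProduct]
    simp only [h1]
    rw [Equiv.sum_comp E fun A => ∏ j, ((∏ i, b.1 (E a j i) (A j i)) * columnVector (C j) (A j)),
      ← Fintype.piFinset_univ, ← Finset.prod_univ_sum (fun _ => Finset.univ)
        fun j A => (∏ i, b.1 (E a j i) (A i)) * columnVector (C j) A]
    simp only [sum_prod_mul_columnVector]
    rw [Pi.smul_apply, smul_eq_mul]
    have h2 : ∀ j, det (of fun i i' : {i // C j i} => b.1 (E a j i) i') =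
        (∏ i : {i // C j i}, b.1 i i) * columnVector (C j) (E a j) := fun j =>
      det_eq_columnVector_mul (C j) (fun i i' h h' => h'.trans_le (l.2.1 h)) b.1 hb _
    simp only [h2]
    rw [Finset.prod_mul_distrib]
    congr 1
    have h3 : ∀ j : Fin N, ∏ i : {i : Fin d // (j : ℕ) < l.row i}, b.1 i i =
        ∏ i, if (j : ℕ) < l.row i then b.1 i i else 1 := by
      intro j
      rw [← Finset.prod_filter]
      exact (Finset.prod_subtype _ (by simp) fun i => b.1 i i).symm
    refine (Finset.prod_congr rfl fun j _ => h3 j).trans ?_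
    rw [Finset.prod_comm]
    refine Finset.prod_congr rfl fun i _ => ?_
    rw [← Finset.prod_filter, Finset.prod_const, card_filter_val_lt (l.row_le i)]
  -- Labelling every box by its own row gives the coordinate 1.
  · have := congrFun h (E.symm fun _ i => i)
    simp [columnVector_val] at this

end ColumnVector

/-! ### Irreducible modules generated by highest weight vectors -/

section Existence

variable {d N : ℕ}

theorem exists_orthonormal_frame {n : Type*} [Fintype n] (K : Submodule ℂ (n → ℂ)) :
    ∃ (m : ℕ) (e : Fin m → n → ℂ), (∀ i, e i ∈ K) ∧
      (∀ i j, star (e i) ⬝ᵥ e j = if i = j then 1 else 0) ∧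
      ∀ x ∈ K, x = ∑ i, (star (e i) ⬝ᵥ x) • e i := by
  let L := WithLp.linearEquiv 2 ℂ (n → ℂ)
  let K' : Submodule ℂ (EuclideanSpace ℂ n) := K.comap L.toLinearMap
  let b := stdOrthonormalBasis ℂ K'
  have hin : ∀ x y : EuclideanSpace ℂ n, inner ℂ x y = star (x.ofLp) ⬝ᵥ y.ofLp := fun x y => by
    rw [EuclideanSpace.inner_eq_star_dotProduct, dotProduct_comm]
  refine ⟨_, fun i => (b i : EuclideanSpace ℂ n).ofLp, fun i => (b i).2, fun i j => ?_,
    fun x hx => ?_⟩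
  · rw [← hin, ← Submodule.coe_inner, orthonormal_iff_ite.1 b.orthonormal]
  · have h := congrArg (fun v : K' => (v : EuclideanSpace ℂ n).ofLp)
      (b.sum_repr' ⟨WithLp.toLp 2 x, hx⟩)
    simp only [Submodule.coe_inner, hin] at h
    refine h.symm.trans ?_
    simp

theorem exists_unit_mem {n : Type*} [Fintype n] (K : Submodule ℂ (n → ℂ))
    (h : ∃ x ∈ K, x ≠ 0) : ∃ x ∈ K, star x ⬝ᵥ x = 1 := by
  obtain ⟨m, e, he, ho, hK⟩ := exists_orthonormal_frame K
  obtain ⟨x, hx, h0⟩ := h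
  have : Nonempty (Fin m) := by
    by_contra h
    rw [not_nonempty_iff] at h
    exact h0 (by rw [hK x hx]; simp)
  obtain ⟨i⟩ := this
  exact ⟨e i, he i, by simp [ho]⟩

/-- Elements of the power span mapping a unit highest weight vector `ψ` to an orthonormal basis of
the module that `ψ` generates. -/
structure HighestWeightFrame (N : ℕ) (w : Fin d → ℕ) where
  ψ : (Fin N → Fin d) → ℂ
  mem : ψ ∈ highestWeightSpace N w
  unit : star ψ ⬝ᵥ ψ = 1
  dim : ℕ
  x : Fin dim → Matrix (Fin N → Fin d) (Fin N → Fin d) ℂ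
  x_mem : ∀ i, x i ∈ powerSpan d N
  orthonormal : ∀ i j, star (x i *ᵥ ψ) ⬝ᵥ (x j *ᵥ ψ) = if i = j then 1 else 0
  complete : ∀ M ∈ powerSpan d N, M *ᵥ ψ = ∑ i, (star (x i *ᵥ ψ) ⬝ᵥ (M *ᵥ ψ)) • (x i *ᵥ ψ)

theorem nonempty_highestWeightFrame {w : Fin d → ℕ} (h : ∃ ψ ∈ highestWeightSpace N w, ψ ≠ 0) :
    Nonempty (HighestWeightFrame N w) := by
  obtain ⟨ψ, hψ, h1⟩ := exists_unit_mem _ h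
  obtain ⟨m, e, he, ho, hK⟩ := exists_orthonormal_frame
    ((powerSpan d N).map ((Matrix.mulVecBilin ℂ ℂ).flip ψ))
  choose x hx hxe using he
  have hxe' : ∀ i, x i *ᵥ ψ = e i := hxe
  exact ⟨⟨ψ, hψ, h1, m, x, hx, fun i j => by rw [hxe', hxe', ho], fun M hM => by
    simp only [hxe']
    exact hK _ ⟨M, hM, rfl⟩⟩⟩

namespace HighestWeightFrame

variable {w : Fin d → ℕ} (F : HighestWeightFrame N w)

/-- An element of the power span annihilating `ψ` annihilates all highest weight vectors of the
same weight. -/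
theorem mulVec_eq_zero {M : Matrix (Fin N → Fin d) (Fin N → Fin d) ℂ} (hM : M ∈ powerSpan d N)
    (h0 : M *ᵥ F.ψ = 0) {η : (Fin N → Fin d) → ℂ} (hη : η ∈ highestWeightSpace N w) :
    M *ᵥ η = 0 := by
  rw [← dotProduct_star_self_eq_zero, ← conjTranspose_conjTranspose M, ← star_dotProduct_mulVec,
    mulVec_mulVec, conjTranspose_conjTranspose, star_dotProduct_mulVec_eq hη hη F.mem F.unit
      (powerSpan_mul_mem (powerSpan_conjTranspose_mem hM) hM), ← mulVec_mulVec, h0]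
  simp

/-- Linear relations among the vectors `M ψ` transfer to every `η` of the same weight, so all such
`η` carry the same matrix representation. -/
theorem mulVec_eq_sum {M : Matrix (Fin N → Fin d) (Fin N → Fin d) ℂ} (hM : M ∈ powerSpan d N)
    {η : (Fin N → Fin d) → ℂ} (hη : η ∈ highestWeightSpace N w) :
    M *ᵥ η = ∑ i, (star (F.x i *ᵥ F.ψ) ⬝ᵥ (M *ᵥ F.ψ)) • (F.x i *ᵥ η) := by
  have h := F.mulVec_eq_zero (M := M - ∑ i, (star (F.x i *ᵥ F.ψ) ⬝ᵥ (M *ᵥ F.ψ)) • F.x i)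
    (sub_mem hM (sum_mem fun i _ => Submodule.smul_mem _ _ (F.x_mem i))) (by
      rw [sub_mulVec, sum_mulVec]
      simp only [smul_mulVec]
      rw [← F.complete M hM, sub_self]) hη
  rwa [sub_mulVec, sum_mulVec, sub_eq_zero, Finset.sum_congr rfl fun i _ => smul_mulVec _ _ _] at h

theorem star_dotProduct_x {η η' : (Fin N → Fin d) → ℂ} (hη : η ∈ highestWeightSpace N w)
    (hη' : η' ∈ highestWeightSpace N w) (i j : Fin F.dim) :
    star (F.x i *ᵥ η) ⬝ᵥ (F.x j *ᵥ η') = (if i = j then 1 else 0) * (star η ⬝ᵥ η') := by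
  rw [← conjTranspose_conjTranspose (F.x i), ← star_dotProduct_mulVec, mulVec_mulVec,
    star_dotProduct_mulVec_eq hη hη' F.mem F.unit
      (powerSpan_mul_mem (powerSpan_conjTranspose_mem (F.x_mem i)) (F.x_mem j)), ← mulVec_mulVec,
    star_dotProduct_mulVec, conjTranspose_conjTranspose, F.orthonormal]

/-- The matrix of `M` on the module generated by `ψ`. -/
def compress (M : Matrix (Fin N → Fin d) (Fin N → Fin d) ℂ) : Matrix (Fin F.dim) (Fin F.dim) ℂ :=
  of fun j i => star (F.x j *ᵥ F.ψ) ⬝ᵥ (M *ᵥ (F.x i *ᵥ F.ψ))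

theorem mulVec_x {M : Matrix (Fin N → Fin d) (Fin N → Fin d) ℂ} (hM : M ∈ powerSpan d N)
    {η : (Fin N → Fin d) → ℂ} (hη : η ∈ highestWeightSpace N w) (i : Fin F.dim) :
    M *ᵥ (F.x i *ᵥ η) = ∑ j, F.compress M j i • (F.x j *ᵥ η) := by
  rw [mulVec_mulVec, F.mulVec_eq_sum (powerSpan_mul_mem hM (F.x_mem i)) hη]
  simp only [← mulVec_mulVec]
  rfl

theorem compress_one : F.compress 1 = 1 := by
  ext i j
  rw [compress, of_apply, one_mulVec, F.orthonormal, one_apply]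

theorem compress_mul {M M' : Matrix (Fin N → Fin d) (Fin N → Fin d) ℂ}
    (hM' : M' ∈ powerSpan d N) :
    F.compress (M * M') = F.compress M * F.compress M' := by
  ext j i
  rw [mul_apply, compress, of_apply, ← mulVec_mulVec, F.mulVec_x hM' F.mem, mulVec_sum,
    dotProduct_sum]
  refine Finset.sum_congr rfl fun k _ => ?_
  rw [mulVec_smul, dotProduct_smul, smul_eq_mul, mul_comm]
  rfl

/-- The representation of `GL(d)` on the module generated by `ψ`, in an orthonormal basis. -/
def rep : Representation ℂ (GL (Fin d) ℂ) (Fin F.dim → ℂ) where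
  toFun g := toLin' (F.compress (tensorPower N g.1))
  map_one' := by rw [Units.val_one, tensorPower_one, compress_one, toLin'_one]; rfl
  map_mul' g h := by
    rw [Units.val_mul, tensorPower_mul, F.compress_mul (tensorPower_mem_powerSpan _), toLin'_mul]
    rfl

/-- The inclusion of the module generated by `ψ`. -/
def incl : (Fin F.dim → ℂ) →ₗ[ℂ] ((Fin N → Fin d) → ℂ) :=
  Fintype.linearCombination ℂ fun i => F.x i *ᵥ F.ψ

theorem incl_apply (v : Fin F.dim → ℂ) : F.incl v = ∑ i, v i • (F.x i *ᵥ F.ψ) := rfl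

theorem star_dotProduct_incl (v : Fin F.dim → ℂ) (i : Fin F.dim) :
    star (F.x i *ᵥ F.ψ) ⬝ᵥ F.incl v = v i := by
  rw [incl_apply, dotProduct_sum]
  simp [dotProduct_smul, F.orthonormal]

theorem incl_injective : Function.Injective F.incl := fun u v h => by
  funext i
  rw [← F.star_dotProduct_incl u, h, F.star_dotProduct_incl]

theorem incl_rep (g : GL (Fin d) ℂ) (v : Fin F.dim → ℂ) :
    F.incl (F.rep g v) = tensorPower N g.1 *ᵥ F.incl v := by
  rw [incl_apply, incl_apply, mulVec_sum]
  simp only [mulVec_smul, F.mulVec_x (tensorPower_mem_powerSpan _) F.mem, Finset.smul_sum,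
    smul_smul]
  rw [Finset.sum_comm]
  refine Finset.sum_congr rfl fun j _ => ?_
  rw [← Finset.sum_smul]
  congr 1
  rw [show F.rep g v = F.compress (tensorPower N g.1) *ᵥ v from rfl, mulVec, dotProduct]
  exact Finset.sum_congr rfl fun i _ => mul_comm (F.compress _ j i) (v i)

theorem exists_incl_eq {M : Matrix (Fin N → Fin d) (Fin N → Fin d) ℂ} (hM : M ∈ powerSpan d N) :
    ∃ v, F.incl v = M *ᵥ F.ψ :=
  ⟨_, (F.complete M hM).symm⟩

theorem exists_mulVec_eq (v : Fin F.dim → ℂ) : ∃ M ∈ powerSpan d N, F.incl v = M *ᵥ F.ψ :=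
  ⟨∑ i, v i • F.x i, sum_mem fun i _ => Submodule.smul_mem _ _ (F.x_mem i), by
    rw [incl_apply, sum_mulVec]; simp only [smul_mulVec]⟩

/-- A vector of the module that is orthogonal to the whole module is orthogonal to itself. -/
theorem eq_zero_of_forall {φ : (Fin N → Fin d) → ℂ} {u : Fin F.dim → ℂ} (hu : F.incl u = φ)
    (h : ∀ M ∈ powerSpan d N, star φ ⬝ᵥ M *ᵥ F.ψ = 0) : φ = 0 := by
  obtain ⟨M, hM, hMu⟩ := F.exists_mulVec_eq u
  have := h M hM
  rw [← hMu, hu] at this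
  exact dotProduct_star_self_eq_zero.1 this

theorem one_mem_powerSpan : (1 : Matrix (Fin N → Fin d) (Fin N → Fin d) ℂ) ∈ powerSpan d N :=
  tensorPower_one (d := d) (N := N) ▸ tensorPower_mem_powerSpan 1

theorem exists_incl_eq_ψ : ∃ v, F.incl v = F.ψ := by
  simpa using F.exists_incl_eq one_mem_powerSpan

theorem ψ_ne_zero : F.ψ ≠ 0 := fun h => by simpa [h] using F.unit

theorem hasHighestWeight : HasHighestWeight F.rep w := by
  obtain ⟨v, hv⟩ := F.exists_incl_eq_ψ
  refine ⟨v, fun h => F.ψ_ne_zero (by rw [← hv, h, map_zero]), fun b hb => F.incl_injective ?_⟩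
  rw [incl_rep, map_smul, hv, F.mem b hb]

/-- A nonzero invariant subspace contains a highest weight vector. Another weight would make it
orthogonal to the module; so it has weight `w`, is a multiple of `ψ`, and `ψ` generates everything.
-/
theorem isIrreducible : F.rep.IsIrreducible := by
  obtain ⟨v₀, hv₀⟩ := F.exists_incl_eq_ψ
  have hv₀' : v₀ ≠ 0 := fun h => F.ψ_ne_zero (by rw [← hv₀, h, map_zero])
  refine { exists_pair_ne := ⟨⊥, ⊤, fun h => hv₀' ?_⟩, eq_bot_or_eq_top := fun W => ?_ }
  · have : v₀ ∈ (⊤ : Subrepresentation F.rep).toSubmodule := Submodule.mem_top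
    rw [← h] at this
    exact this
  · by_contra! hW
    have hne : W.toSubmodule.map F.incl ≠ ⊥ := fun h => hW.1 <|
      Subrepresentation.toSubmodule_injective <|
        by
          rw [← LinearMap.le_ker_iff_map, LinearMap.ker_eq_bot.2 F.incl_injective] at h
          exact le_bot_iff.1 h
    have hinv : ∀ M ∈ powerSpan d N, ∀ φ ∈ W.toSubmodule.map F.incl,
        M *ᵥ φ ∈ W.toSubmodule.map F.incl := by
      intro M hM φ hφ
      induction hM using powerSpan_induction with
      | posDef X hX =>
        obtain ⟨v, hv, rfl⟩ := hφ
        exact ⟨F.rep hX.isUnit.unit v, W.apply_mem_toSubmodule _ hv, F.incl_rep _ _⟩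
      | zero => simp
      | add A B _ _ hA hB => rw [add_mulVec]; exact add_mem hA hB
      | smul c A _ hA => rw [smul_mulVec]; exact Submodule.smul_mem _ _ hA
    obtain ⟨a, φ, ⟨v, hv, rfl⟩, hφ0, hφ⟩ := exists_mem_highestWeightSpace _ hinv hne
    have hψ : F.ψ ∈ W.toSubmodule.map F.incl := by
      by_cases hw : content a = w
      · rw [hw] at hφ
        -- The part orthogonal to `ψ` is again of highest weight `w`, hence orthogonal to every `M
        -- ψ`.
        have hsub : F.incl v - (star F.ψ ⬝ᵥ F.incl v) • F.ψ = 0 := by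
          have h2 := sub_mem hφ (Submodule.smul_mem _ (star F.ψ ⬝ᵥ F.incl v) F.mem)
          refine F.eq_zero_of_forall (u := v - (star F.ψ ⬝ᵥ F.incl v) • v₀)
            (by rw [map_sub, map_smul, hv₀]) fun M hM => ?_
          rw [star_dotProduct_mulVec_eq h2 F.mem F.mem F.unit hM, star_sub, sub_dotProduct,
            star_smul, smul_dotProduct, F.unit, ← star_dotProduct_star, star_star]
          simp
        have hc : star F.ψ ⬝ᵥ F.incl v ≠ 0 := fun h => hφ0 (by simpa [h] using hsub)
        rw [sub_eq_zero] at hsub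
        have := Submodule.smul_mem (W.toSubmodule.map F.incl) (star F.ψ ⬝ᵥ F.incl v)⁻¹ ⟨v, hv, rfl⟩
        rwa [hsub, dotProduct_smul, F.unit, smul_eq_mul, mul_one, inv_smul_smul₀ hc] at this
      · exact absurd (F.eq_zero_of_forall rfl fun M hM =>
          star_dotProduct_mulVec_eq_zero hw hφ F.mem hM) hφ0
    refine hW.2 (Subrepresentation.toSubmodule_injective (eq_top_iff.2 fun u _ => ?_))
    obtain ⟨M', hM', hu⟩ := F.exists_mulVec_eq u
    obtain ⟨u', hu', h⟩ := hinv M' hM' _ hψ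
    rwa [← F.incl_injective (h.trans hu.symm)]

end HighestWeightFrame

end Existence

/-! ### Assembling the Schur-Weyl unitary -/

section Decomposition

variable {d N : ℕ}

/-- The Young diagram given by a dominant content. -/
def contentDiagram (a : Fin N → Fin d) (ha : Antitone (content a)) : Diagram d N :=
  ⟨content a, ha, sum_content a⟩

/-- Moving `x` across the inner product reduces the Gram matrix to inner products of highest weight
vectors. -/
theorem gram_of_frames (F : ∀ l : Diagram d N, HighestWeightFrame N l.row) (m : Diagram d N → ℕ)
    (η : ∀ l, Fin (m l) → (Fin N → Fin d) → ℂ) (hη : ∀ l i, η l i ∈ highestWeightSpace N l.row)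
    (hηo : ∀ l i j, star (η l i) ⬝ᵥ η l j = if i = j then 1 else 0)
    (p q : Σ l, Fin ((F l).dim) × Fin (m l)) :
    star ((F p.1).x p.2.1 *ᵥ η p.1 p.2.2) ⬝ᵥ ((F q.1).x q.2.1 *ᵥ η q.1 q.2.2) =
      if p = q then 1 else 0 := by
  obtain ⟨l, i, s⟩ := p
  obtain ⟨l', j, t⟩ := q
  by_cases h : l = l'
  · subst h
    simp only
    rw [(F l).star_dotProduct_x (hη l s) (hη l t), hηo]
    by_cases h1 : i = j <;> by_cases h2 : s = t <;> simp [h1, h2]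
  · rw [if_neg fun h' => h (congrArg Sigma.fst h')]
    simp only
    rw [← conjTranspose_conjTranspose ((F l).x i), ← star_dotProduct_mulVec, mulVec_mulVec]
    exact star_dotProduct_mulVec_eq_zero (fun h' => h (Subtype.ext h')) (hη l s) (hη l' t)
      (powerSpan_mul_mem (powerSpan_conjTranspose_mem ((F l).x_mem i)) ((F l').x_mem j))

/-- Existence of the Schur-Weyl decomposition. -/
theorem nonempty_schurWeyl (d N : ℕ) : Nonempty (SchurWeyl d N) := by
  have F : ∀ l : Diagram d N, HighestWeightFrame N l.row := fun l =>
    (nonempty_highestWeightFrame l.exists_highestWeight).some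
  choose m η hη hηo hηc using fun l : Diagram d N =>
    exists_orthonormal_frame (highestWeightSpace N l.row)
  have hgram := gram_of_frames F m η hη hηo
  let v : (Σ l, Fin ((F l).dim) × Fin (m l)) → (Fin N → Fin d) → ℂ :=
    fun p => (F p.1).x p.2.1 *ᵥ η p.1 p.2.2
  have hv : ∀ p q, star (v p) ⬝ᵥ v q = if p = q then 1 else 0 := hgram
  let U : Matrix (Σ l, Fin ((F l).dim) × Fin (m l)) (Fin N → Fin d) ℂ := of fun p a => star (v p a)
  have hUv : ∀ x, U *ᵥ x = fun p => star (v p) ⬝ᵥ x := fun x => rfl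
  have hUU : U * Uᴴ = 1 := by
    ext p q
    rw [one_apply, ← hv, mul_apply]
    exact Finset.sum_congr rfl fun a _ => by simp [U]
  have hMv : ∀ M ∈ powerSpan d N, ∀ l i s,
      M *ᵥ v ⟨l, i, s⟩ = ∑ j, (F l).compress M j i • v ⟨l, j, s⟩ := fun M hM l i s =>
    (F l).mulVec_x hM (hη l s) i
  -- The vectors `v p` are complete: their orthogonal complement is invariant, so if nonzero it
  -- would contain a highest weight vector `φ`. But `φ` lies in the span of the `η l s`, which are
  -- themselves combinations of the `v p`.
  have hker : ∀ x, U *ᵥ x = 0 → x = 0 := by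
    by_contra! hx
    obtain ⟨x, hx, hx0⟩ := hx
    have hmem : ∀ y, y ∈ LinearMap.ker U.mulVecLin ↔ ∀ p, star (v p) ⬝ᵥ y = 0 := fun y => by
      rw [LinearMap.mem_ker, mulVecLin_apply, hUv, funext_iff]
      rfl
    obtain ⟨a, φ, hφ, hφ0, hφw⟩ := exists_mem_highestWeightSpace (LinearMap.ker U.mulVecLin)
      (fun M hM y hy => (hmem _).2 fun ⟨l, i, s⟩ => by
        rw [star_dotProduct_mulVec, hMv _ (powerSpan_conjTranspose_mem hM), star_sum,
          sum_dotProduct]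
        exact Finset.sum_eq_zero fun j _ => by
          rw [star_smul, smul_dotProduct, (hmem y).1 hy, smul_zero])
      ((Submodule.ne_bot_iff _).2 ⟨x, hx, hx0⟩)
    let l : Diagram d N := contentDiagram a (antitone_of_mem_highestWeightSpace hφw hφ0)
    refine hφ0 ((hηc l φ hφw).trans (Finset.sum_eq_zero fun s _ => ?_))
    have hs := (F l).mulVec_eq_sum HighestWeightFrame.one_mem_powerSpan (hη l s)
    rw [one_mulVec] at hs
    rw [hs, star_sum, sum_dotProduct, Finset.sum_eq_zero, zero_smul]
    intro i _
    rw [star_smul, smul_dotProduct, show star ((F l).x i *ᵥ η l s) ⬝ᵥ φ = 0 from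
      (hmem φ).1 hφ ⟨l, i, s⟩, smul_zero]
  have hUU' : Uᴴ * U = 1 := by
    refine ext_of_mulVec_single fun a => ?_
    rw [one_mulVec, ← sub_eq_zero]
    apply hker
    rw [mulVec_sub, mulVec_mulVec, ← Matrix.mul_assoc, hUU, Matrix.one_mul, sub_self]
  refine ⟨⟨fun l => (F l).dim, m, fun l => ?_, fun l => (F l).rep, fun l => (F l).isIrreducible,
    fun l => (F l).hasHighestWeight, U, hUU, hUU', fun g => ?_⟩⟩
  · by_contra h
    rw [Nat.pos_iff_ne_zero, not_not] at h
    have : IsEmpty (Fin (m l)) := by rw [h]; infer_instance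
    exact (F l).ψ_ne_zero ((hηc l _ (F l).mem).trans (by simp))
  · ext ⟨l, i, s⟩ ⟨l', j, t⟩
    have h1 : (U * tensorPower N g.1 * Uᴴ) ⟨l, i, s⟩ ⟨l', j, t⟩ =
        star (v ⟨l, i, s⟩) ⬝ᵥ tensorPower N g.1 *ᵥ v ⟨l', j, t⟩ := by
      rw [dotProduct_mulVec, mul_apply, dotProduct]
      exact Finset.sum_congr rfl fun a _ => by simp [U, mul_apply, vecMul, dotProduct]
    rw [h1, hMv _ (tensorPower_mem_powerSpan _), dotProduct_sum]
    simp only [dotProduct_smul, hv]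
    by_cases h : l = l'
    · subst h
      rw [blockDiagonal'_apply_eq, kroneckerMap_apply,
        show LinearMap.toMatrix' ((F l).rep g) = (F l).compress (tensorPower N g.1) from
          LinearMap.toMatrix'_toLin' _, one_apply]
      rw [Finset.sum_eq_single i]
      · by_cases hst : s = t <;> simp [hst]
      · intro k _ hk
        rw [if_neg (by simpa using fun h' => absurd h'.symm hk), smul_zero]
      · simp
    · rw [blockDiagonal'_apply_ne _ _ _ h]
      exact Finset.sum_eq_zero fun k _ => by
        rw [if_neg fun h' => h (congrArg Sigma.fst h'), smul_zero]

end Decomposition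

/-! ### Bounding the dimensions by counting monomials -/

section Dimension

variable {d N : ℕ}

namespace SchurWeyl

variable (S : SchurWeyl d N)

/-- The embedding of `R_λ` as `R_λ ⊗ e_s` into `(ℂ^d)^{⊗N}`. -/
def embed (l : Diagram d N) (s : Fin (S.dimM l)) :
    (Fin (S.dimR l) → ℂ) →ₗ[ℂ] ((Fin N → Fin d) → ℂ) :=
  Fintype.linearCombination ℂ fun i => S.Uᴴ.col ⟨l, i, s⟩

theorem embed_apply (l : Diagram d N) (s : Fin (S.dimM l)) (x : Fin (S.dimR l) → ℂ) :
    S.embed l s x = ∑ i, x i • S.Uᴴ.col ⟨l, i, s⟩ := rfl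

theorem embed_injective (l : Diagram d N) (s : Fin (S.dimM l)) :
    Function.Injective (S.embed l s) := by
  refine (injective_iff_map_eq_zero _).2 fun x hx => funext fun i => ?_
  have h : ∀ j, S.U ⟨l, i, s⟩ ⬝ᵥ S.Uᴴ.col ⟨l, j, s⟩ = if i = j then 1 else 0 := by
    intro j
    have h := congrFun (congrFun S.U_mul_conjTranspose ⟨l, i, s⟩) ⟨l, j, s⟩
    rw [one_apply, mul_apply] at h
    simpa [dotProduct] using h
  have h0 := congrArg (S.U ⟨l, i, s⟩ ⬝ᵥ ·) hx
  simpa [embed_apply, dotProduct_sum, h] using h0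

theorem embed_rep (l : Diagram d N) (s : Fin (S.dimM l)) (g : GL (Fin d) ℂ)
    (x : Fin (S.dimR l) → ℂ) :
    S.embed l s (S.rep l g x) = tensorPower N g.1 *ᵥ S.embed l s x := by
  have hcol : ∀ i, tensorPower N g.1 *ᵥ S.Uᴴ.col ⟨l, i, s⟩ =
      ∑ j, LinearMap.toMatrix' (S.rep l g) j i • S.Uᴴ.col ⟨l, j, s⟩ := by
    intro i
    have h : tensorPower N g.1 * S.Uᴴ = S.Uᴴ * blockDiagonal' fun l =>
        LinearMap.toMatrix' (S.rep l g) ⊗ₖ (1 : Matrix (Fin (S.dimM l)) (Fin (S.dimM l)) ℂ) := by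
      rw [← S.block_form g, ← Matrix.mul_assoc, ← Matrix.mul_assoc, S.conjTranspose_mul_U,
        Matrix.one_mul]
    funext a
    have ha := congrFun (congrFun h a) ⟨l, i, s⟩
    rw [mul_apply, mul_apply] at ha
    refine ha.trans ?_
    rw [Fintype.sum_sigma, Finset.sum_eq_single l (fun l' _ hl' => Finset.sum_eq_zero fun p _ => by
      rw [blockDiagonal'_apply_ne _ _ _ hl', mul_zero]) (by simp), Fintype.sum_prod_type,
      Finset.sum_apply]
    refine Finset.sum_congr rfl fun j _ => ?_
    rw [Finset.sum_eq_single s]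
    · simp [blockDiagonal'_apply_eq, mul_comm]
    · intro t _ ht
      simp [blockDiagonal'_apply_eq, one_apply_ne ht]
    · simp
  rw [embed_apply, embed_apply, mulVec_sum]
  simp only [mulVec_smul, hcol, Finset.smul_sum, smul_smul]
  rw [Finset.sum_comm]
  refine Finset.sum_congr rfl fun j _ => ?_
  rw [← Finset.sum_smul, ← LinearMap.toMatrix'_mulVec (S.rep l g), mulVec, dotProduct]
  congr 1
  exact Finset.sum_congr rfl fun i _ => mul_comm _ _

theorem exists_embed_mem_highestWeightSpace (l : Diagram d N) (s : Fin (S.dimM l)) :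
    ∃ v, v ≠ 0 ∧ S.embed l s v ∈ highestWeightSpace N l.row := by
  obtain ⟨v, hv, h⟩ := S.highestWeight l
  exact ⟨v, hv, fun b hb => by rw [← embed_rep, h b hb, map_smul]⟩

/-- The vectors reachable from `v` form a subrepresentation containing `v`, which irreducibility
makes everything. -/
theorem exists_mulVec_eq_embed (l : Diagram d N) (s : Fin (S.dimM l)) {v : Fin (S.dimR l) → ℂ}
    (hv : v ≠ 0) (x : Fin (S.dimR l) → ℂ) :
    ∃ M ∈ powerSpan d N, M *ᵥ S.embed l s v = S.embed l s x := by
  have := S.irreducible l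
  let W : Subrepresentation (S.rep l) :=
    { toSubmodule := ((powerSpan d N).map
        ((Matrix.mulVecBilin ℂ ℂ).flip (S.embed l s v))).comap (S.embed l s)
      apply_mem_toSubmodule := fun g y ⟨M, hM, hy⟩ =>
        ⟨tensorPower N g.1 * M, powerSpan_mul_mem (tensorPower_mem_powerSpan _) hM, by
          rw [embed_rep, ← hy]
          exact (mulVec_mulVec _ _ _).symm⟩ }
  have hvW : v ∈ W.toSubmodule := ⟨1, HighestWeightFrame.one_mem_powerSpan, one_mulVec _⟩
  rcases eq_bot_or_eq_top W with h | h
  · rw [h] at hvW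
    exact absurd hvW hv
  · have hx : x ∈ (⊤ : Subrepresentation (S.rep l)).toSubmodule := Submodule.mem_top
    rw [← h] at hx
    exact hx

end SchurWeyl

/-- How often each pair of values is taken. -/
def pairContent (a b : Fin N → Fin d) (p : Fin d × Fin d) : ℕ :=
  (Finset.univ.filter fun k => (a k, b k) = p).card

/-- The positions in the first `r` columns on or below the diagonal. -/
def trapezoid (d r : ℕ) : Finset (Fin d × Fin d) :=
  Finset.univ.filter fun p => p.2 ≤ p.1 ∧ (p.2 : ℕ) < r

/-- The exponents, supported on the trapezoid, whose column sums are `w`. -/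
def columnExponents (N r : ℕ) (w : Fin d → ℕ) : Finset (Fin d × Fin d → ℕ) :=
  (Finset.piAntidiag (trapezoid d r) N).filter fun f => ∀ j, ∑ i, f (i, j) = w j

theorem sum_pairContent_left (a b : Fin N → Fin d) (j : Fin d) :
    ∑ i, pairContent a b (i, j) = content b j := by
  rw [content, Finset.card_eq_sum_card_fiberwise (f := a) (t := Finset.univ) (by simp)]
  simp only [pairContent, Finset.filter_filter, Prod.mk.injEq, and_comm]

theorem pairContent_mem {r : ℕ} {l : Diagram d N} (hl : l.AtMost r) {a b : Fin N → Fin d}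
    (hab : b ≤ a) (hb : content b = l.row) :
    pairContent a b ∈ columnExponents N r l.row := by
  have hcol : ∀ j, ∑ i, pairContent a b (i, j) = l.row j := fun j => by
    rw [sum_pairContent_left, hb]
  have hzero : ∀ p, pairContent a b p ≠ 0 → p ∈ trapezoid d r := by
    intro p hp
    obtain ⟨k, hk⟩ := Finset.card_pos.1 (Nat.pos_of_ne_zero hp)
    obtain rfl := (Finset.mem_filter.1 hk).2
    refine Finset.mem_filter.2 ⟨Finset.mem_univ _, hab k, ?_⟩
    by_contra h
    have h0 := hl (b k) (not_lt.1 h)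
    rw [← hb, content, Finset.card_eq_zero] at h0
    exact Finset.notMem_empty k (h0 ▸ by simp)
  refine Finset.mem_filter.2 ⟨Finset.mem_piAntidiag.2 ⟨?_, hzero⟩, hcol⟩
  rw [Finset.sum_subset (Finset.subset_univ _) fun p _ hp => by_contra fun h => hp (hzero p h),
    Fintype.sum_prod_type_right]
  simp only [hcol]
  exact l.2.2

theorem prod_eq_prod_pow_pairContent (L : Matrix (Fin d) (Fin d) ℂ) (a b : Fin N → Fin d) :
    tensorPower N L a b = ∏ p : Fin d × Fin d, L p.1 p.2 ^ pairContent a b p := by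
  rw [tensorPower_apply, ← Finset.prod_fiberwise' Finset.univ (fun k => (a k, b k))
    fun p => L p.1 p.2]
  simp [pairContent]

/-- Expanding `L^{⊗N} ψ` in monomials of the entries of a lower triangular `L` gives one spanning
vector for each admissible exponent. -/
theorem SchurWeyl.dimR_le (S : SchurWeyl d N) {r : ℕ} {l : Diagram d N} (hl : l.AtMost r) :
    S.dimR l ≤ (columnExponents N r l.row).card := by
  let s : Fin (S.dimM l) := ⟨0, S.dimM_pos l⟩
  obtain ⟨v, hv, hψ⟩ := S.exists_embed_mem_highestWeightSpace l s
  set ψ := S.embed l s v with hψdef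
  let A := columnExponents N r l.row
  -- The coefficient of the monomial with exponent `α`.
  let Ψ : A → (Fin N → Fin d) → ℂ := fun α a =>
    ∑ b ∈ Finset.univ.filter fun b => pairContent a b = α.1, ψ b
  have hlow : ∀ L : Matrix (Fin d) (Fin d) ℂ, (∀ i j : Fin d, i < j → L i j = 0) →
      tensorPower N L *ᵥ ψ ∈ Submodule.span ℂ (Set.range Ψ) := by
    intro L hL
    have h : tensorPower N L *ᵥ ψ =
        ∑ α : A, (∏ p : Fin d × Fin d, L p.1 p.2 ^ α.1 p) • Ψ α := by
      funext a
      have hne : ∀ b, tensorPower N L a b * ψ b ≠ 0 → pairContent a b ∈ A := fun b hb =>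
        pairContent_mem hl (fun k => by
          by_contra hk
          exact left_ne_zero_of_mul hb
            (Finset.prod_eq_zero (Finset.mem_univ k) (hL _ _ (not_le.1 hk))))
          (highestWeightSpace_content hψ (right_ne_zero_of_mul hb))
      rw [mulVec, dotProduct, Finset.sum_apply, ← Finset.sum_filter_of_ne fun b _ => hne b,
        ← Finset.sum_fiberwise_of_maps_to (t := A) fun b hb => (Finset.mem_filter.1 hb).2,
        ← Finset.sum_coe_sort]
      refine Finset.sum_congr rfl fun α _ => ?_
      rw [Pi.smul_apply, smul_eq_mul, Finset.mul_sum]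
      have hf : (Finset.univ.filter fun b => pairContent a b ∈ A).filter
          (fun b => pairContent a b = α.1) = Finset.univ.filter fun b => pairContent a b = α.1 := by
        ext b
        simp only [Finset.mem_filter, Finset.mem_univ, true_and, and_iff_right_iff_imp]
        exact fun h => h ▸ α.2
      rw [hf]
      refine Finset.sum_congr rfl fun b hb => ?_
      rw [prod_eq_prod_pow_pairContent, (Finset.mem_filter.1 hb).2]
    rw [h]
    exact sum_mem fun α _ => Submodule.smul_mem _ _ (Submodule.subset_span ⟨α, rfl⟩)
  have hrange : LinearMap.range (S.embed l s) ≤ Submodule.span ℂ (Set.range Ψ) := by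
    rintro _ ⟨x, rfl⟩
    obtain ⟨M, hM, h⟩ := S.exists_mulVec_eq_embed l s hv x
    rw [← h]
    refine Submodule.span_le.2 ?_ (mulVec_mem_span_lower hψ hM)
    rintro _ ⟨L, hL, rfl⟩
    exact hlow L hL
  calc S.dimR l = Module.finrank ℂ (Fin (S.dimR l) → ℂ) := by simp
    _ = Module.finrank ℂ (LinearMap.range (S.embed l s)) :=
      (LinearMap.finrank_range_of_inj (S.embed_injective l s)).symm
    _ ≤ Module.finrank ℂ (Submodule.span ℂ (Set.range Ψ)) := Submodule.finrank_mono hrange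
    _ ≤ Fintype.card A := finrank_range_le_card Ψ
    _ = A.card := Fintype.card_coe A

theorem SchurWeyl.card_encIdx_le (S : SchurWeyl d N) (r : ℕ) :
    Fintype.card (S.EncIdx r) ≤ ((Finset.piAntidiag (trapezoid d r) N).filter
      fun f => Antitone fun j => ∑ i, f (i, j)).card := by
  rw [Fintype.card_sigma]
  simp only [Fintype.card_fin]
  calc ∑ l : Retained d N r, S.dimR l.1
      ≤ ∑ l : Retained d N r, (columnExponents N r l.1.row).card :=
        Finset.sum_le_sum fun l _ => S.dimR_le l.2
    _ = (Finset.univ.biUnion fun l : Retained d N r => columnExponents N r l.1.row).card := by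
        -- The column sums of an exponent recover the diagram, so the sets are disjoint.
        refine (Finset.card_biUnion fun l _ l' _ hne => ?_).symm
        rw [Function.onFun, Finset.disjoint_left]
        intro f hf hf'
        refine hne (Subtype.ext (Subtype.ext (funext fun j => ?_)))
        exact ((Finset.mem_filter.1 hf).2 j).symm.trans ((Finset.mem_filter.1 hf').2 j)
    _ ≤ _ := by
        refine Finset.card_le_card fun f hf => ?_
        obtain ⟨l, -, hl⟩ := Finset.mem_biUnion.1 hf
        obtain ⟨h1, h2⟩ := Finset.mem_filter.1 hl
        exact Finset.mem_filter.2 ⟨h1, by simp only [h2]; exact l.1.2.1⟩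

end Dimension

/-! ### Numerical bounds on the number of qubits -/

section Counting

theorem card_piAntidiag_nat {ι : Type*} [DecidableEq ι] (s : Finset ι) (n : ℕ) :
    (Finset.piAntidiag s n).card = (s.card + n - 1).choose n := by
  rw [← Finset.card_finsuppAntidiag_nat_eq_choose]
  refine Finset.card_bij' (fun f hf => Finsupp.onFinset s f (Finset.mem_piAntidiag.1 hf).2)
    (fun f _ => f) ?_ ?_ ?_ ?_
  · intro f hf
    rw [Finset.mem_finsuppAntidiag]
    exact ⟨(Finset.mem_piAntidiag.1 hf).1, Finsupp.support_onFinset_subset⟩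
  · intro f hf
    rw [Finset.mem_finsuppAntidiag] at hf
    exact Finset.mem_piAntidiag.2 ⟨hf.1, fun i hi => hf.2 (Finsupp.mem_support_iff.2 hi)⟩
  · intros; rfl
  · intros; ext; rfl

theorem card_trapezoid {d r : ℕ} (hrd : r ≤ d) :
    2 * (trapezoid d r).card + r ^ 2 = 2 * d * r + r := by
  have h : (trapezoid d r).card = ∑ j ∈ Finset.range r, (d - j) := by
    rw [trapezoid, Finset.card_filter, Fintype.sum_prod_type_right]
    have h1 : ∀ j : Fin d, (∑ i : Fin d, if j ≤ i ∧ (j : ℕ) < r then 1 else 0) =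
        if (j : ℕ) < r then d - j else 0 := by
      intro j
      by_cases hj : (j : ℕ) < r
      · simp only [hj, and_true, if_true, ← Finset.card_filter]
        rw [← Fin.card_Ici]
        congr 1
        ext i
        simp
      · simp [hj]
    simp only [h1]
    rw [Fin.sum_univ_eq_sum_range (fun j => if j < r then d - j else 0) d, ← Finset.sum_filter]
    congr 1
    ext j
    simp only [Finset.mem_filter, Finset.mem_range]
    omega
  rw [h]
  clear h
  induction r with
  | zero => simp
  | succ r ih =>
    have := ih (by omega)
    rw [Finset.sum_range_succ, mul_add]
    obtain ⟨k, rfl⟩ := Nat.exists_eq_add_of_le (show r ≤ d by omega)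
    rw [show r + k - r = k by omega]
    nlinarith

/-- Each step multiplies the binomial by `(N+e+1)/(e+1) ≤ N+2`. The factor 2 is kept to pay for the
ceiling of the logarithm. -/
theorem two_mul_choose_le {N e : ℕ} (he : 2 ≤ e) : 2 * (N + e).choose e ≤ (N + 2) ^ e := by
  induction e, he using Nat.le_induction with
  | base =>
    rw [Nat.choose_two_right, Nat.mul_div_cancel' (Nat.even_mul_pred_self _).two_dvd]
    rw [pow_two]
    exact Nat.mul_le_mul_left _ (by omega)
  | succ e he ih =>
    have h := Nat.add_one_mul_choose_eq (N + e) e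
    refine le_of_mul_le_mul_left ?_ (Nat.succ_pos e)
    calc (e + 1) * (2 * (N + (e + 1)).choose (e + 1))
        = (N + e + 1) * (2 * (N + e).choose e) := by rw [← add_assoc]; linarith
      _ ≤ ((e + 1) * (N + 2)) * (N + 2) ^ e := Nat.mul_le_mul (by nlinarith) ih
      _ = (e + 1) * (N + 2) ^ (e + 1) := by ring

/-- For `d = 2` the base is only `N + 1`, so dominance is needed: it confines `f (1, 1)` to at most
`N / 2`. The summand `+ 1` cannot be dropped, as `N = 2` gives equality. -/
theorem two_mul_card_two_le (N : ℕ) :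
    2 * ((Finset.piAntidiag (trapezoid 2 2) N).filter
      fun f => Antitone fun j => ∑ i, f (i, j)).card ≤ (N + 1) ^ 2 + 1 := by
  have h : ((Finset.piAntidiag (trapezoid 2 2) N).filter
      fun f => Antitone fun j => ∑ i, f (i, j)).card ≤
      ((Finset.range (N / 2 + 1)).sigma fun c => Finset.range (N + 1 - c)).card := by
    have hmem : ∀ f ∈ (Finset.piAntidiag (trapezoid 2 2) N).filter
        (fun f => Antitone fun j => ∑ i, f (i, j)),
        f (0, 1) = 0 ∧ f (0, 0) + f (1, 0) + f (1, 1) = N ∧ f (1, 1) ≤ f (0, 0) + f (1, 0) := by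
      intro f hf
      obtain ⟨hf, hanti⟩ := Finset.mem_filter.1 hf
      obtain ⟨hsum, hsupp⟩ := Finset.mem_piAntidiag.1 hf
      have h01 : f (0, 1) = 0 := by
        by_contra h
        simpa [trapezoid] using hsupp _ h
      rw [Finset.sum_subset (Finset.subset_univ _) fun p _ hp => by_contra fun h => hp (hsupp p h),
        Fintype.sum_prod_type] at hsum
      have h10 := hanti (show (0 : Fin 2) ≤ 1 by decide)
      simp only [Fin.sum_univ_two] at hsum h10
      omega
    refine Finset.card_le_card_of_injOn (fun f => ⟨f (1, 1), f (0, 0)⟩) (fun f hf => ?_)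
      fun f hf g hg hfg => ?_
    · have := hmem f hf
      simp only [Finset.coe_sigma, Set.mem_sigma_iff, Finset.coe_range, Set.mem_Iio]
      omega
    · have h1 := hmem f hf
      have h2 := hmem g hg
      simp only [Sigma.mk.injEq, heq_eq_eq] at hfg
      funext p
      obtain ⟨i, j⟩ := p
      fin_cases i <;> fin_cases j <;> simp only [Fin.mk_zero, Fin.mk_one] <;> omega
  have hs : ∀ m n, m ≤ n → 2 * ∑ c ∈ Finset.range m, (n - c) + m ^ 2 = 2 * n * m + m := by
    intro m n hm
    induction m with
    | zero => simp
    | succ m ih =>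
      have := ih (by omega)
      rw [Finset.sum_range_succ, mul_add]
      obtain ⟨k, rfl⟩ := Nat.exists_eq_add_of_le (show m ≤ n by omega)
      rw [show m + k - m = k by omega]
      nlinarith
  rw [Finset.card_sigma] at h
  simp only [Finset.card_range] at h
  have h1 := hs (N / 2 + 1) (N + 1) (by omega)
  obtain ⟨m, rfl | rfl⟩ := Nat.even_or_odd' N
  · rw [show 2 * m / 2 = m by omega] at h h1
    nlinarith [Nat.le_self_pow two_ne_zero m]
  · rw [show (2 * m + 1) / 2 = m by omega] at h h1
    nlinarith

/-- For `D > 1`, `2^(clog D - 1) ≤ D - 1` gives `2^(clog D) ≤ 2 D - 2 < M^e`; this leaves room for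
the `+ 1`. -/
theorem clog_lt_mul_logb {D M e : ℕ} (hM : 2 ≤ M) (he : e ≠ 0) (h : 2 * D ≤ M ^ e + 1) :
    (Nat.clog 2 D : ℝ) < e * Real.logb 2 M := by
  have hlt : 2 ^ Nat.clog 2 D < M ^ e := by
    by_cases hD : D ≤ 1
    · rw [Nat.clog_of_right_le_one hD, pow_zero]
      exact Nat.one_lt_pow he (by omega)
    · have h1 := Nat.pow_pred_clog_lt_self one_lt_two (show 1 < D by omega)
      have h2 := Nat.clog_pos one_lt_two (show 1 < D by omega)
      rw [← Nat.succ_pred_eq_of_pos h2, pow_succ]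
      omega
  have hlt' : (2 : ℝ) ^ Nat.clog 2 D < (M : ℝ) ^ e := by exact_mod_cast hlt
  have := Real.logb_lt_logb one_lt_two (by positivity) hlt'
  rwa [Real.logb_pow, Real.logb_pow, Real.logb_self_eq_one one_lt_two, mul_one] at this

theorem SchurWeyl.numQubits_lt {d N r : ℕ} (S : SchurWeyl d N) (hN : 1 ≤ N) (hr : 1 ≤ r)
    (hrd : r ≤ d) (hdr : 3 ≤ d ∨ 2 ≤ r) :
    (S.numQubits r : ℝ) <
      (2 * (d : ℝ) * r - (r : ℝ) ^ 2 + r - 2) / 2 * Real.logb 2 ((N : ℝ) + d - 1) := by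
  have hcard := card_trapezoid hrd
  set t := (trapezoid d r).card with ht
  -- The condition `3 ≤ d ∨ 2 ≤ r` makes the exponent `t - 1` at least 2.
  have ht3 : 3 ≤ t := by
    rcases hdr with h | h <;> nlinarith
  have hM : (N : ℝ) + d - 1 = ((N + d - 1 : ℕ) : ℝ) := by
    rw [Nat.cast_sub (by omega)]; push_cast; ring
  have he : (2 * (d : ℝ) * r - (r : ℝ) ^ 2 + r - 2) / 2 = ((t - 1 : ℕ) : ℝ) := by
    rw [Nat.cast_sub (by omega)]
    have : (2 * (t : ℝ) + (r : ℝ) ^ 2) = 2 * d * r + r := by exact_mod_cast hcard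
    push_cast
    linarith
  rw [hM, he]
  refine clog_lt_mul_logb (by omega) (by omega) ?_
  have hle := S.card_encIdx_le r
  -- For `d ≥ 3` dominance is discarded and `N + 2 ≤ N + d - 1` suffices; otherwise `d = r = 2`.
  by_cases hd : 3 ≤ d
  · have h1 := hle.trans (Finset.card_filter_le _ _)
    rw [card_piAntidiag_nat, ← ht, show t + N - 1 = N + (t - 1) by omega,
      Nat.choose_symm_add] at h1
    have h2 := two_mul_choose_le (N := N) (e := t - 1) (by omega)
    have h3 := Nat.pow_le_pow_left (show N + 2 ≤ N + d - 1 by omega) (t - 1)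
    omega
  · obtain rfl : d = 2 := by omega
    obtain rfl : r = 2 := by omega
    have h := two_mul_card_two_le N
    rw [show t - 1 = 2 by omega, show N + 2 - 1 = N + 1 by omega]
    omega

end Counting

/-! ### Kraus operators of the encoding and the decoding -/

section Channels

theorem kraus_posSemidef {m n : Type*} [Fintype m] [Fintype n] (K : Matrix n m ℂ)
    {k : ℕ} {X : Matrix (m × Fin k) (m × Fin k) ℂ} (hX : X.PosSemidef) :
    (of fun p q : n × Fin k =>
      (K * (of fun i j => X (i, p.2) (j, q.2)) * Kᴴ) p.1 q.1).PosSemidef := by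
  classical
  have h : (of fun p q : n × Fin k => (K * (of fun i j => X (i, p.2) (j, q.2)) * Kᴴ) p.1 q.1) =
      (K ⊗ₖ (1 : Matrix (Fin k) (Fin k) ℂ)) * X * (K ⊗ₖ (1 : Matrix (Fin k) (Fin k) ℂ))ᴴ := by
    ext p q
    simp [mul_apply, Fintype.sum_prod_type, one_apply, conjTranspose_apply, apply_ite,
      Finset.sum_ite_eq, Finset.sum_mul]
  rw [h]
  exact hX.mul_mul_conjTranspose_same _

/-- A map with a Kraus decomposition is completely positive. -/
theorem ampliate_posSemidef_of_kraus {ι m n : Type*} [Fintype ι] [Fintype m] [Fintype n]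
    (Φ : Matrix m m ℂ →ₗ[ℂ] Matrix n n ℂ) (K : ι → Matrix n m ℂ)
    (hΦ : ∀ X, Φ X = ∑ i, K i * X * (K i)ᴴ) (k : ℕ) {X : Matrix (m × Fin k) (m × Fin k) ℂ}
    (hX : X.PosSemidef) : (ampliate Φ k X).PosSemidef := by
  have h : ampliate Φ k X = ∑ i, of fun p q : n × Fin k =>
      (K i * (of fun i j => X (i, p.2) (j, q.2)) * (K i)ᴴ) p.1 q.1 := by
    ext p q
    simp [ampliate, hΦ, Matrix.sum_apply]
  rw [h]
  exact posSemidef_sum _ fun i _ => kraus_posSemidef (K i) hX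

theorem exists_factor_of_posSemidef {n : Type*} [Fintype n] {σ : Matrix n n ℂ}
    (hσ : σ.PosSemidef) :
    ∃ (m : ℕ) (B : Fin m → n → ℂ), ∀ i j, σ i j = ∑ q, B q i * star (B q j) := by
  obtain ⟨m, B, rfl⟩ := Matrix.posSemidef_iff_eq_sum_vecMulVec.1 hσ
  exact ⟨m, B, fun i j => by simp [Matrix.sum_apply, vecMulVec_apply]⟩

namespace SchurWeyl

variable {d N : ℕ} (S : SchurWeyl d N) (r : ℕ)

theorem exists_density (h : Nonempty (S.EncIdx r)) :
    ∃ σ : Matrix (S.EncIdx r) (S.EncIdx r) ℂ, IsDensity σ := by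
  obtain ⟨i⟩ := h
  refine ⟨diagonal (Pi.single i 1), PosSemidef.diagonal fun j => ?_, ?_⟩
  · by_cases h : j = i
    · subst h; simp
    · simp [h]
  · simp [trace_diagonal]

theorem dimR_pos (l : Diagram d N) : 0 < S.dimR l := by
  obtain ⟨v, hv, -⟩ := S.highestWeight l
  by_contra h
  have : IsEmpty (Fin (S.dimR l)) := by
    rw [Nat.pos_iff_ne_zero, not_not] at h
    rw [h]; infer_instance
  exact hv (Subsingleton.elim _ _)

/-- The diagram with a single row of length `N` is always retained. -/
theorem nonempty_encIdx (hr : 1 ≤ r) (hrd : r ≤ d) : Nonempty (S.EncIdx r) := by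
  let z : Fin d := ⟨0, by omega⟩
  refine ⟨⟨⟨⟨fun i => if i = z then N else 0, fun i j hij => ?_, by simp⟩, fun i hi => ?_⟩,
    ⟨0, S.dimR_pos _⟩⟩⟩
  · by_cases hj : j = z
    · have : i = z := le_antisymm (hj ▸ hij) (Nat.zero_le _)
      simp [hj, this]
    · simp [hj]
  · refine if_neg fun h => ?_
    rw [h] at hi
    exact absurd hi (by simp [z]; omega)

/-- The Kraus operators of the decoding. -/
def decodeKraus (p : Σ l : Retained d N r, Fin (S.dimM l.1)) :
    Matrix (Fin N → Fin d) (S.EncIdx r) ℂ :=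
  of fun a q => if h : q.1 = p.1 then
    (Real.sqrt (S.dimM p.1.1 : ℝ)⁻¹ : ℂ) * star (S.U ⟨p.1.1, h ▸ q.2, p.2⟩ a) else 0

/-- The maximally mixed state on `M_λ` is the uniform mixture of its basis vectors, whence one Kraus
operator for each diagram and basis vector, weighted by `1/√m_λ`. -/
theorem decode_eq_kraus (Y : Matrix (S.EncIdx r) (S.EncIdx r) ℂ) :
    S.decode r Y = ∑ p, S.decodeKraus r p * Y * (S.decodeKraus r p)ᴴ := by
  ext a b
  rw [Matrix.sum_apply, Fintype.sum_sigma]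
  change (S.Uᴴ * blockDiagonal' (S.decodeBlock r Y) * S.U) a b = _
  have hl : ∀ (l : Retained d N r) (s : Fin (S.dimM l.1)),
      (S.decodeKraus r ⟨l, s⟩ * Y * (S.decodeKraus r ⟨l, s⟩)ᴴ) a b =
      ∑ j, ∑ i, (S.dimM l.1 : ℂ)⁻¹ * (star (S.U ⟨l.1, i, s⟩ a) * Y ⟨l, i⟩ ⟨l, j⟩ *
        S.U ⟨l.1, j, s⟩ b) := by
    intro l s
    have hsqrt : (Real.sqrt (S.dimM l.1 : ℝ)⁻¹ : ℂ) * (Real.sqrt (S.dimM l.1 : ℝ)⁻¹ : ℂ) =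
        (S.dimM l.1 : ℂ)⁻¹ := by
      rw [← Complex.ofReal_mul, Real.mul_self_sqrt (by positivity)]
      push_cast
      rfl
    rw [mul_apply, Fintype.sum_sigma, Finset.sum_eq_single l]
    · refine Finset.sum_congr rfl fun j _ => ?_
      rw [mul_apply, Fintype.sum_sigma, Finset.sum_eq_single l, Finset.sum_mul]
      · refine Finset.sum_congr rfl fun i _ => ?_
        simp only [decodeKraus, of_apply, conjTranspose_apply, dif_pos, star_mul',
          Complex.star_def, Complex.conj_ofReal, Complex.conj_conj]
        rw [← hsqrt]
        ring
      · intro l' _ hl'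
        exact Finset.sum_eq_zero fun i _ => by simp [decodeKraus, hl']
      · simp
    · intro l' _ hl'
      exact Finset.sum_eq_zero fun i _ => by simp [decodeKraus, hl', conjTranspose_apply]
    · simp
  simp only [hl]
  rw [mul_apply, Fintype.sum_sigma]
  have hz : ∀ l : Diagram d N, ¬ l.AtMost r → ∑ p : Fin (S.dimR l) × Fin (S.dimM l),
      (S.Uᴴ * blockDiagonal' (S.decodeBlock r Y)) a ⟨l, p⟩ * S.U ⟨l, p⟩ b = 0 := by
    intro l h
    refine Finset.sum_eq_zero fun p _ => ?_
    rw [mul_apply, Finset.sum_eq_zero, zero_mul]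
    rintro ⟨l', p'⟩ -
    by_cases hll : l' = l
    · subst hll
      rw [blockDiagonal'_apply_eq, decodeBlock, dif_neg h]
      simp
    · rw [blockDiagonal'_apply_ne _ _ _ hll, mul_zero]
  rw [← Finset.sum_filter_of_ne (p := fun l : Diagram d N => l.AtMost r)
    fun l _ h => by_contra fun h' => h (hz l h'),
    Finset.sum_subtype (p := fun l : Diagram d N => l.AtMost r) _ (by simp)]
  refine Finset.sum_congr rfl fun l _ => ?_
  rw [Fintype.sum_prod_type_right]
  refine Finset.sum_congr rfl fun s _ => Finset.sum_congr rfl fun j _ => ?_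
  rw [mul_apply, Fintype.sum_sigma, Finset.sum_eq_single l.1, Fintype.sum_prod_type, Finset.sum_mul]
  · refine Finset.sum_congr rfl fun i _ => ?_
    rw [Finset.sum_eq_single s]
    · rw [blockDiagonal'_apply_eq, decodeBlock, dif_pos l.2, kroneckerMap_apply]
      simp
      ring
    · intro t _ ht
      rw [blockDiagonal'_apply_eq, decodeBlock, dif_pos l.2, kroneckerMap_apply]
      simp [one_apply_ne ht]
    · simp
  · intro l' _ hl'
    exact Finset.sum_eq_zero fun p _ => by rw [blockDiagonal'_apply_ne _ _ _ hl', mul_zero]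
  · simp

theorem trace_blockDiagonal' {o : Type*} [Fintype o] [DecidableEq o] {m : o → Type*}
    [∀ i, Fintype (m i)] (M : ∀ i, Matrix (m i) (m i) ℂ) :
    (blockDiagonal' M).trace = ∑ i, (M i).trace := by
  simp [trace, Fintype.sum_sigma, blockDiagonal'_apply_eq]

theorem decode_isChannel : IsChannel (S.decode r) where
  completelyPositive k X hX :=
    ampliate_posSemidef_of_kraus _ (S.decodeKraus r) (S.decode_eq_kraus r) k hX
  tracePreserving Y := by
    change (S.Uᴴ * blockDiagonal' (S.decodeBlock r Y) * S.U).trace = _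
    rw [Matrix.mul_assoc, trace_mul_comm, Matrix.mul_assoc, S.U_mul_conjTranspose, Matrix.mul_one,
      trace_blockDiagonal', trace, Fintype.sum_sigma,
      ← Finset.sum_filter_of_ne (p := fun l : Diagram d N => l.AtMost r) fun l _ h =>
        by_contra fun h' => h (by rw [decodeBlock, dif_neg h', trace_zero]),
      Finset.sum_subtype (p := fun l : Diagram d N => l.AtMost r) _ (by simp)]
    refine Finset.sum_congr rfl fun l _ => ?_
    have hm : (S.dimM l.1 : ℂ) ≠ 0 := Nat.cast_ne_zero.2 (S.dimM_pos l.1).ne'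
    rw [decodeBlock, dif_pos l.2, trace_kronecker, trace_smul, trace_one, Fintype.card_fin,
      smul_eq_mul, inv_mul_cancel₀ hm, mul_one]
    rfl

/-- The Kraus operators of the part of the encoding that keeps the retained blocks. -/
def encodeKraus (p : Σ l : Retained d N r, Fin (S.dimM l.1)) :
    Matrix (S.EncIdx r) (Fin N → Fin d) ℂ :=
  of fun q a => if h : q.1 = p.1 then S.U ⟨p.1.1, h ▸ q.2, p.2⟩ a else 0

theorem trace_failure (ρ : Matrix (Fin N → Fin d) (Fin N → Fin d) ℂ) :
    ((1 - S.retainedProj r) * ρ).trace =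
      ∑ p : Σ l, Fin (S.dimR l) × Fin (S.dimM l),
        if p.1.AtMost r then 0 else (S.U * ρ * S.Uᴴ) p p := by
  have h : 1 - S.retainedProj r = S.Uᴴ * diagonal (fun p : Σ l, Fin (S.dimR l) × Fin (S.dimM l) =>
      if p.1.AtMost r then (0 : ℂ) else 1) * S.U := by
    have h1 : (diagonal (fun p : Σ l, Fin (S.dimR l) × Fin (S.dimM l) =>
        if p.1.AtMost r then (1 : ℂ) else 0)) + diagonal (fun p =>
        if p.1.AtMost r then (0 : ℂ) else 1) = 1 := by
      rw [diagonal_add, ← diagonal_one]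
      congr 1
      funext p
      split_ifs <;> simp
    rw [sub_eq_iff_eq_add', retainedProj, ← Matrix.add_mul, ← Matrix.mul_add, h1, Matrix.mul_one,
      S.conjTranspose_mul_U]
  rw [h, Matrix.mul_assoc, Matrix.mul_assoc, trace_mul_comm, Matrix.mul_assoc, trace]
  refine Finset.sum_congr rfl fun p _ => ?_
  rw [diag_apply, diagonal_mul]
  split_ifs <;> simp

theorem encode_apply (σ : Matrix (S.EncIdx r) (S.EncIdx r) ℂ)
    (ρ : Matrix (Fin N → Fin d) (Fin N → Fin d) ℂ) :
    S.encode r σ ρ = blockDiagonal' (fun l : Retained d N r =>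
        traceRight (blockDiag' (S.U * ρ * S.Uᴴ) l.1)) +
      ((1 - S.retainedProj r) * ρ).trace • σ := rfl

theorem encode_retained_eq_kraus (ρ : Matrix (Fin N → Fin d) (Fin N → Fin d) ℂ) :
    blockDiagonal' (fun l : Retained d N r => traceRight (blockDiag' (S.U * ρ * S.Uᴴ) l.1)) =
      ∑ p, S.encodeKraus r p * ρ * (S.encodeKraus r p)ᴴ := by
  ext ⟨l, i⟩ ⟨l', j⟩
  have hz : ∀ (l₁ l₂ : Retained d N r) (s : Fin (S.dimM l₂.1)) (i : Fin (S.dimR l₁.1)), l₁ ≠ l₂ →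
      S.encodeKraus r ⟨l₂, s⟩ ⟨l₁, i⟩ = 0 := fun l₁ l₂ s i h => by
    funext a; simp [encodeKraus, h]
  rw [Matrix.sum_apply, Fintype.sum_sigma, Finset.sum_eq_single l]
  · by_cases h : l = l'
    · subst h
      rw [blockDiagonal'_apply_eq, traceRight, of_apply]
      refine Finset.sum_congr rfl fun s _ => ?_
      simp [blockDiag'_apply, mul_apply, encodeKraus, conjTranspose_apply]
    · rw [blockDiagonal'_apply_ne _ _ _ h]
      refine (Finset.sum_eq_zero fun s _ => ?_).symm
      rw [mul_apply]
      refine Finset.sum_eq_zero fun a _ => ?_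
      rw [conjTranspose_apply, hz l' l s j (Ne.symm h)]
      simp
  · intro l₂ _ hl₂
    refine Finset.sum_eq_zero fun s _ => ?_
    rw [Matrix.mul_assoc, mul_apply]
    refine Finset.sum_eq_zero fun a _ => ?_
    rw [hz l l₂ s i (Ne.symm hl₂)]
    simp
  · simp

theorem encode_isChannel {σ : Matrix (S.EncIdx r) (S.EncIdx r) ℂ} (hσ : IsDensity σ) :
    IsChannel (S.encode r σ) where
  completelyPositive k X hX := by
    obtain ⟨m, B, hB⟩ := exists_factor_of_posSemidef hσ.1
    -- The failure branch measures the discarded basis vectors and prepares `σ = ∑ B_q B_qᴴ`; its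
    -- Kraus operators have rank at most one.
    refine ampliate_posSemidef_of_kraus _
      (Sum.elim (S.encodeKraus r) fun p :
          (Σ l, Fin (S.dimR l) × Fin (S.dimM l)) × Fin m =>
        of fun i a => if p.1.1.AtMost r then 0 else B p.2 i * S.U p.1 a) (fun ρ => ?_) k hX
    rw [Fintype.sum_sum_type, encode_apply, encode_retained_eq_kraus]
    simp only [Sum.elim_inl, Sum.elim_inr]
    congr 1
    rw [trace_failure]
    ext i j
    rw [Matrix.smul_apply, hB, Matrix.sum_apply, Fintype.sum_prod_type, smul_eq_mul, Finset.sum_mul]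
    refine Finset.sum_congr rfl fun p _ => ?_
    rw [Finset.mul_sum]
    refine Finset.sum_congr rfl fun q _ => ?_
    by_cases h : p.1.AtMost r
    · simp [h, mul_apply]
    · simp only [h, if_false, mul_apply, of_apply, conjTranspose_apply, Finset.sum_mul, star_mul']
      refine Finset.sum_congr rfl fun b _ => Finset.sum_congr rfl fun a _ => ?_
      ring
  tracePreserving ρ := by
    rw [encode_apply, trace_add, trace_smul, hσ.2, smul_eq_mul, mul_one, trace_failure,
      trace_blockDiagonal']
    have h1 : ρ.trace = (S.U * ρ * S.Uᴴ).trace := by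
      rw [trace_mul_comm, ← Matrix.mul_assoc, S.conjTranspose_mul_U, Matrix.one_mul]
    have h2 : ∑ l : Retained d N r, (traceRight (blockDiag' (S.U * ρ * S.Uᴴ) l.1)).trace =
        ∑ p : Σ l, Fin (S.dimR l) × Fin (S.dimM l),
          if p.1.AtMost r then (S.U * ρ * S.Uᴴ) p p else 0 := by
      rw [Fintype.sum_sigma]
      have h3 : ∀ l : Diagram d N, (∑ p : Fin (S.dimR l) × Fin (S.dimM l),
          if l.AtMost r then (S.U * ρ * S.Uᴴ) ⟨l, p⟩ ⟨l, p⟩ else 0) =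
          if l.AtMost r then (traceRight (blockDiag' (S.U * ρ * S.Uᴴ) l)).trace else 0 := by
        intro l
        split_ifs
        · rw [Fintype.sum_prod_type]
          rfl
        · simp
      simp only [h3]
      rw [← Finset.sum_filter,
        Finset.sum_subtype (p := fun l : Diagram d N => l.AtMost r) _ (by simp)]
    rw [h1, h2, trace, ← Finset.sum_add_distrib]
    refine Finset.sum_congr rfl fun p _ => ?_
    split_ifs <;> simp

end SchurWeyl

end Channels

/-! ### Vanishing of low-rank states outside the retained blocks -/

section ZeroError

variable {d N : ℕ}

/-- The weight identity extends from invertible to singular matrices by continuity: `u + t` is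
invertible for all but finitely many `t`. -/
theorem tensorPower_mulVec_of_upper {w : Fin d → ℕ} {ψ : (Fin N → Fin d) → ℂ}
    (hψ : ψ ∈ highestWeightSpace N w) (u : Matrix (Fin d) (Fin d) ℂ)
    (hu : ∀ i j : Fin d, j < i → u i j = 0) :
    tensorPower N u *ᵥ ψ = (∏ i, u i i ^ w i) • ψ := by
  have hdet : ∀ t : ℂ, (u + diagonal fun _ => t).det = ∏ i, (u i i + t) := fun t => by
    have hup : (u + diagonal fun _ => t).IsUpperTriangular := fun i j (hij : j < i) => by
      simp [hu i j hij, hij.ne']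
    simp [det_of_isUpperTriangular hup]
  funext a
  have hc1 : Continuous fun t : ℂ => (tensorPower N (u + diagonal fun _ => t) *ᵥ ψ) a := by
    simp only [mulVec, dotProduct, tensorPower_apply, Matrix.add_apply, diagonal_apply]
    refine continuous_finsetSum _ fun b _ => (continuous_finsetProd _ fun k _ => ?_).mul
      continuous_const
    split_ifs <;> fun_prop
  have hc2 : Continuous fun t : ℂ => (∏ i, (u i i + t) ^ w i) * ψ a := by fun_prop
  have hd : Dense (Set.range fun i => -u i i)ᶜ :=
    (Set.finite_range _).countable.dense_compl ℂ
  have h := congrFun (hc1.ext_on hd hc2 fun t ht => by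
    have h0 : (u + diagonal fun _ => t).det ≠ 0 := by
      rw [hdet]
      exact Finset.prod_ne_zero_iff.2 fun i _ h => ht ⟨i, (eq_neg_of_add_eq_zero_right h).symm⟩
    have h1 := congrFun (hψ (Matrix.GeneralLinearGroup.mkOfDetNeZero _ h0) fun i j hij => by
      simp [hu i j hij, hij.ne']) a
    simpa using h1) 0
  simpa using h

/-- The QR decomposition, with the upper triangular factor obtained by left multiplication. -/
theorem exists_mul_upper (X : Matrix (Fin d) (Fin d) ℂ) :
    ∃ Q u : Matrix (Fin d) (Fin d) ℂ, (∀ i j : Fin d, j < i → u i j = 0) ∧ X = Q * u ∧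
      u.rank ≤ X.rank := by
  let f : Fin d → EuclideanSpace ℂ (Fin d) := fun j => WithLp.toLp 2 (X.col j)
  have h : Module.finrank ℂ (EuclideanSpace ℂ (Fin d)) = Fintype.card (Fin d) := by simp
  let b := (InnerProductSpace.gramSchmidtOrthonormalBasis h f).toBasis
  let c := (EuclideanSpace.basisFun (Fin d) ℂ).toBasis
  have hX : c.toMatrix f = X := by
    ext i j
    simp [c, f, Module.Basis.toMatrix_apply]
  refine ⟨c.toMatrix b, b.toMatrix f, fun i j hij =>
    InnerProductSpace.gramSchmidtOrthonormalBasis_inv_isUpperTriangular h f hij, ?_, ?_⟩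
  · rw [Module.Basis.toMatrix_mul_toMatrix, hX]
  · rw [← Module.Basis.toMatrix_mul_toMatrix b c f, hX]
    exact rank_mul_le_right _ _

/-- An upper triangular matrix of rank at most `r` has a zero among any `r + 1` leading diagonal
entries. -/
theorem exists_diag_eq_zero_of_rank_le {r : ℕ} {u : Matrix (Fin d) (Fin d) ℂ}
    (hu : ∀ i j : Fin d, j < i → u i j = 0) (hr : u.rank ≤ r) {i₀ : Fin d} (hi : r ≤ (i₀ : ℕ)) :
    ∃ i ≤ i₀, u i i = 0 := by
  by_contra! h
  have hdet : (u.submatrix (Subtype.val : Set.Iic i₀ → Fin d) Subtype.val).det ≠ 0 := by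
    have hup : (u.submatrix (Subtype.val : Set.Iic i₀ → Fin d) Subtype.val).IsUpperTriangular :=
      fun i j hij => hu _ _ hij
    rw [det_of_isUpperTriangular hup]
    exact Finset.prod_ne_zero_iff.2 fun i _ => h i.1 i.2
  have h1 := rank_of_isUnit (u.submatrix (Subtype.val : Set.Iic i₀ → Fin d) Subtype.val)
    ((isUnit_iff_isUnit_det _).2 hdet.isUnit)
  let v : Set.Iic i₀ → Fin d := Subtype.val
  have h2 : (u.submatrix v v).rank ≤ u.rank := rank_submatrix_le u v v
  have h3 : Fintype.card (Set.Iic i₀) = i₀ + 1 := by simp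
  rw [h1, h3] at h2
  omega

/-- After `X = Q * u` the vector is scaled by a product containing `0 ^ λ_i`, where `λ_i > 0`
because row `i` lies at or above a nonempty row. -/
theorem tensorPower_mulVec_eq_zero {r : ℕ} {l : Diagram d N} (hl : ¬ l.AtMost r)
    {ψ : (Fin N → Fin d) → ℂ} (hψ : ψ ∈ highestWeightSpace N l.row)
    {X : Matrix (Fin d) (Fin d) ℂ} (hX : X.rank ≤ r) : tensorPower N X *ᵥ ψ = 0 := by
  obtain ⟨i₀, hl⟩ := not_forall.1 hl
  obtain ⟨hi₀, h0⟩ := Classical.not_imp.1 hl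
  obtain ⟨Q, u, hu, rfl, hrank⟩ := exists_mul_upper X
  obtain ⟨i, hi, hui⟩ := exists_diag_eq_zero_of_rank_le hu (hrank.trans hX) hi₀
  have hw : l.row i ≠ 0 := fun h => h0 (Nat.le_zero.1 ((l.2.1 hi).trans h.le))
  rw [tensorPower_mul, ← mulVec_mulVec, tensorPower_mulVec_of_upper hψ u hu,
    Finset.prod_eq_zero (Finset.mem_univ i) (by rw [hui, zero_pow hw]), zero_smul, mulVec_zero]

namespace SchurWeyl

variable (S : SchurWeyl d N)

/-- `block_form` covers only invertible matrices; since these include the positive definite ones,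
linearity reaches singular states too. -/
theorem exists_block_form {M : Matrix (Fin N → Fin d) (Fin N → Fin d) ℂ}
    (hM : M ∈ powerSpan d N) :
    ∃ A : ∀ l, Matrix (Fin (S.dimR l)) (Fin (S.dimR l)) ℂ, S.U * M * S.Uᴴ =
      blockDiagonal' fun l => A l ⊗ₖ (1 : Matrix (Fin (S.dimM l)) (Fin (S.dimM l)) ℂ) := by
  induction hM using powerSpan_induction with
  | posDef X hX => exact ⟨_, S.block_form hX.isUnit.unit⟩
  | zero =>
    refine ⟨0, ?_⟩
    simp only [Pi.zero_apply, zero_kronecker, Matrix.mul_zero, Matrix.zero_mul]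
    exact blockDiagonal'_zero.symm
  | add M M' _ _ h h' =>
    obtain ⟨A, hA⟩ := h
    obtain ⟨A', hA'⟩ := h'
    refine ⟨A + A', ?_⟩
    rw [Matrix.mul_add, Matrix.add_mul, hA, hA', ← blockDiagonal'_add]
    simp only [Pi.add_apply, add_kronecker]
    rfl
  | smul c M _ h =>
    obtain ⟨A, hA⟩ := h
    refine ⟨c • A, ?_⟩
    rw [Matrix.mul_smul, Matrix.smul_mul, hA, ← blockDiagonal'_smul]
    simp only [Pi.smul_apply, smul_kronecker]
    rfl

/-- The block is generated from a highest weight vector by tensor powers `Y^{⊗N}`, and `X * Y` has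
rank at most that of `X`. -/
theorem tensorPower_mulVec_embed {r : ℕ} {l : Diagram d N} (hl : ¬ l.AtMost r)
    (s : Fin (S.dimM l)) {X : Matrix (Fin d) (Fin d) ℂ} (hX : X.rank ≤ r)
    (x : Fin (S.dimR l) → ℂ) : tensorPower N X *ᵥ S.embed l s x = 0 := by
  obtain ⟨v, hv, hψ⟩ := S.exists_embed_mem_highestWeightSpace l s
  obtain ⟨M, hM, h⟩ := S.exists_mulVec_eq_embed l s hv x
  rw [← h]
  clear h
  induction hM using powerSpan_induction with
  | posDef Y _ =>
    rw [mulVec_mulVec, ← tensorPower_mul]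
    exact tensorPower_mulVec_eq_zero hl hψ ((rank_mul_le_left _ _).trans hX)
  | zero => simp
  | add A B _ _ hA hB => rw [add_mulVec, mulVec_add, hA, hB, add_zero]
  | smul c A _ hA => rw [smul_mulVec, mulVec_smul, hA, smul_zero]

theorem tensorPower_block_eq_zero {r : ℕ} {l : Diagram d N} (hl : ¬ l.AtMost r)
    {X : Matrix (Fin d) (Fin d) ℂ} (hX : X.rank ≤ r)
    {A : ∀ l, Matrix (Fin (S.dimR l)) (Fin (S.dimR l)) ℂ}
    (hA : S.U * tensorPower N X * S.Uᴴ =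
      blockDiagonal' fun l => A l ⊗ₖ (1 : Matrix (Fin (S.dimM l)) (Fin (S.dimM l)) ℂ)) :
    A l = 0 := by
  ext i j
  let s : Fin (S.dimM l) := ⟨0, S.dimM_pos l⟩
  have h := congrFun (congrFun hA ⟨l, i, s⟩) ⟨l, j, s⟩
  rw [blockDiagonal'_apply_eq, kroneckerMap_apply, one_apply_eq, mul_one, Matrix.mul_assoc,
    mul_apply] at h
  have hcol := S.tensorPower_mulVec_embed hl s hX (Pi.single j 1)
  have hsingle : S.embed l s (Pi.single j 1) = S.Uᴴ.col ⟨l, j, s⟩ := by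
    rw [embed_apply, Finset.sum_eq_single j (fun k _ hk => by simp [hk]) (by simp)]
    simp
  rw [hsingle] at hcol
  rw [← h, Matrix.zero_apply]
  refine Finset.sum_eq_zero fun a _ => ?_
  have : (tensorPower N X * S.Uᴴ) a ⟨l, j, s⟩ = 0 := congrFun hcol a
  rw [this, mul_zero]

/-- The partial trace of `A_λ ⊗ 1` is `m_λ A_λ`, and decoding divides by `m_λ`. The failure term is
zero because the discarded blocks vanish, so `σ` plays no role. -/
theorem decode_encode {r : ℕ} (σ : Matrix (S.EncIdx r) (S.EncIdx r) ℂ)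
    {ρ : Matrix (Fin d) (Fin d) ℂ} (hρ : ρ.rank ≤ r) :
    S.decode r (S.encode r σ (tensorPower N ρ)) = tensorPower N ρ := by
  obtain ⟨A, hA⟩ := S.exists_block_form (tensorPower_mem_powerSpan (N := N) ρ)
  have h0 : ∀ l : Diagram d N, ¬ l.AtMost r → A l = 0 := fun l hl =>
    S.tensorPower_block_eq_zero hl hρ hA
  have hE : S.encode r σ (tensorPower N ρ) =
      blockDiagonal' fun l : Retained d N r => (S.dimM l.1 : ℂ) • A l.1 := by
    rw [encode_apply, trace_failure, hA, Finset.sum_eq_zero, zero_smul, add_zero]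
    · congr 1
      funext l
      rw [blockDiag'_blockDiagonal']
      ext i j
      simp [traceRight, mul_comm]
    · rintro ⟨l, p⟩ -
      by_cases hl : l.AtMost r
      · simp [hl]
      · simp [hl, blockDiagonal'_apply_eq, h0 l hl]
  have hD : S.decodeBlock r (S.encode r σ (tensorPower N ρ)) =
      fun l => A l ⊗ₖ (1 : Matrix (Fin (S.dimM l)) (Fin (S.dimM l)) ℂ) := by
    funext l
    by_cases hl : l.AtMost r
    · have hm : (S.dimM l : ℂ) ≠ 0 := Nat.cast_ne_zero.2 (S.dimM_pos l).ne'
      rw [decodeBlock, dif_pos hl, hE]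
      ext p q
      simp only [kroneckerMap_apply, of_apply, blockDiagonal'_apply_eq, Matrix.smul_apply,
        smul_eq_mul]
      field_simp
    · rw [decodeBlock, dif_neg hl, h0 l hl, zero_kronecker]
  change S.Uᴴ * blockDiagonal' (S.decodeBlock r _) * S.U = _
  rw [hD, ← hA, Matrix.mul_assoc, Matrix.mul_assoc, Matrix.mul_assoc, S.conjTranspose_mul_U,
    Matrix.mul_one, ← Matrix.mul_assoc, S.conjTranspose_mul_U, Matrix.one_mul]

end SchurWeyl

theorem traceNorm_zero {n : Type*} [Fintype n] [DecidableEq n] :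
    traceNorm (0 : Matrix n n ℂ) = 0 := by
  refine Finset.sum_eq_zero fun i _ => ?_
  rw [(IsHermitian.eigenvalues_eq_zero_iff _).2 (by simp), Pi.zero_apply, Real.sqrt_zero]

theorem SchurWeyl.zeroError (S : SchurWeyl d N) {r : ℕ}
    (σ : Matrix (S.EncIdx r) (S.EncIdx r) ℂ) {X : Type*} [MeasurableSpace X]
    (ens : Ensemble d r X) : ZeroError ens (S.encode r σ) (S.decode r) := by
  have h := fun x => S.decode_encode σ (ens.rank_eq x).le
  refine ⟨h, ?_⟩
  simp only [averageError, h, sub_self, traceNorm_zero, zero_div, integral_zero]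

end ZeroError

end SchurCompression

end

theorem mainTheorem5 (d N r : ℕ) (hN : 1 ≤ N) (hr : 1 ≤ r) (hrd : r ≤ d)
    (hdr : 3 ≤ d ∨ 2 ≤ r) :
    Nonempty (SchurWeyl d N) ∧
    ∀ S : SchurWeyl d N,
      (S.numQubits r : ℝ) <
          (2 * (d : ℝ) * r - (r : ℝ) ^ 2 + r - 2) / 2 * Real.logb 2 ((N : ℝ) + d - 1) ∧
      (∃ σ : Matrix (S.EncIdx r) (S.EncIdx r) ℂ, IsDensity σ) ∧
      IsChannel (S.decode r) ∧
      ∀ σ : Matrix (S.EncIdx r) (S.EncIdx r) ℂ, IsDensity σ →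
        IsChannel (S.encode r σ) ∧
        ∀ (X : Type*) [MeasurableSpace X] (ens : Ensemble d r X),
          ZeroError ens (S.encode r σ) (S.decode r) :=
  ⟨nonempty_schurWeyl d N, fun S => ⟨S.numQubits_lt hN hr hrd hdr,
    S.exists_density r (S.nonempty_encIdx r hr hrd), S.decode_isChannel r,
    fun σ hσ => ⟨S.encode_isChannel r hσ, fun _ _ ens => S.zeroError σ ens⟩⟩⟩
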